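/- All manifolds are smooth, finite-dimensional, Hausdorff, second countable and without boundary. A contact form on a manifold $M$ of dimension $2n+1$ is a smooth $1$-form $\eta$ with $(\mathsf d\eta)^n\wedge\eta$ nowhere zero; a smooth map $f:(M_1,\eta_1)\to(M_2,\eta_2)$ between contact manifolds is an anti-morphism if $f^*\eta_2=-\eta_1$. Let $(M,\eta)$ be a contact manifold, $\Pi:M\to N$ a surjective submersion onto a connected and simply connected manifold $N$, $X$ a smooth vector field on $M$, and $\Lambda$ a manifold. Let $\Sigma:N\times\Lambda\to M$ be a complete solution of the $\Pi$-Hamilton–Jacobi equation for $X$, i.e. a surjective local diffeomorphism such that, for every $\lambda\in\Lambda$, $\sigma_\lambda:=\Sigma(\cdot,\lambda)$ is a section of $\Pi$ with $(\sigma_\lambda)_*\circ\Pi_*\circ X\circ\sigma_\lambda=X\circ\sigma_\lambda$. Suppose that $\Sigma$ is pseudo-isotropic: $\sigma_\lambda^*\mathsf d\eta=0$ for all $\lambda\in\Lambda$. Then there is a smooth function $W:N\times\Lambda\to\mathbb R$ such that $\sigma_\lambda^*\eta=\mathsf d\,(W(\cdot,\lambda))$ for all $\lambda\in\Lambda$.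 For every such $W$, let $\varphi:N\times\Lambda\to T^*\Lambda$ be the map with $\varphi(p,\lambda)\in T^*_\lambda\Lambda$ and $$\langle\varphi(p,\lambda),z\rangle=\langle(\mathsf dW-\Sigma^*\eta)(p,\lambda),(0,z)\rangle\qquad(z\in T_\lambda\Lambda).$$ Let $\theta$ be the canonical $1$-form of $T^*\Lambda$ (given by $\theta_\alpha(v)=\alpha(\pi_*v)$, where $\pi:T^*\Lambda\to\Lambda$), $p_1:T^*\Lambda\times\mathbb R\to T^*\Lambda$ the projection and $z$ the coordinate of $\mathbb R$. Then $\Sigma^*\eta$ is a contact form on $N\times\Lambda$, $p_1^*\theta\mp\mathsf dz$ are contact forms on $T^*\Lambda\times\mathbb R$, the maps $(\varphi,\pm W):N\times\Lambda\to T^*\Lambda\times\mathbb R$ are smooth, and $$(\varphi,W)^*\left(p_1^*\theta-\mathsf dz\right)=-\Sigma^*\eta,\qquad\text{equivalently}\qquad(\varphi,-W)^*\left(p_1^*\theta+\mathsf dz\right)=-\Sigma^*\eta .$$ That is, $(\varphi,W)$ is an anti-morphism of contact manifolds from $(N\times\Lambda,\Sigma^*\eta)$ to $(T^*\Lambda\times\mathbb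 R,\;p_1^*\theta-\mathsf dz)$, and $(\varphi,-W)$ is one to $(T^*\Lambda\times\mathbb R,\;p_1^*\theta+\mathsf dz)$. -/

import Mathlib

open scoped Manifold ContDiff Bundle

noncomputable section

namespace ContactHJ

section Forms

variable {E : Type*} [NormedAddCommGroup E] [NormedSpace ℝ E]
  {H : Type*} [TopologicalSpace H]
  {E' : Type*} [NormedAddCommGroup E'] [NormedSpace ℝ E']
  {H' : Type*} [TopologicalSpace H']

/-- A (not necessarily smooth) differential `1`-form on `M`: a covector at every point. -/
abbrev OneForm (I : ModelWithCorners ℝ E H) (M : Type*) [TopologicalSpace M] [ChartedSpace H M] :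
    Type _ :=
  (p : M) → (TangentSpace I p →L[ℝ] ℝ)

/-- The cotangent bundle `T^*M`, as the (smooth vector) bundle of continuous linear forms on the
tangent spaces. -/
abbrev CotangentBundle (I : ModelWithCorners ℝ E H) (M : Type*) [TopologicalSpace M]
    [ChartedSpace H M] : Type _ :=
  Bundle.TotalSpace (E →L[ℝ] ℝ) (fun p : M => TangentSpace I p →L[ℝ] ℝ)

/-- The model with corners of the cotangent bundle. -/
abbrev cotangentModel (I : ModelWithCorners ℝ E H) :
    ModelWithCorners ℝ (E × (E →L[ℝ] ℝ)) (ModelProd H (E →L[ℝ] ℝ)) :=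
  I.prod 𝓘(ℝ, E →L[ℝ] ℝ)

variable {I : ModelWithCorners ℝ E H} {M : Type*} [TopologicalSpace M] [ChartedSpace H M]
  {I' : ModelWithCorners ℝ E' H'} {M' : Type*} [TopologicalSpace M'] [ChartedSpace H' M']

/-- Smoothness of a `1`-form, as a section of the cotangent bundle. -/
def OneForm.Smooth [IsManifold I ∞ M] (η : OneForm I M) : Prop :=
  ContMDiff I (cotangentModel I) ∞ (fun p => (⟨p, η p⟩ : CotangentBundle I M))

/-- The differential `df` of a real function, as a `1`-form. -/
def OneForm.ofFun (I : ModelWithCorners ℝ E H) (f : M → ℝ) : OneForm I M :=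
  fun p => (mfderiv I 𝓘(ℝ, ℝ) f p : E →L[ℝ] ℝ)

/-- The pullback `f^*η`. -/
def OneForm.pullback (I : ModelWithCorners ℝ E H) {I' : ModelWithCorners ℝ E' H'}
    (f : M → M') (η : OneForm I' M') : OneForm I M :=
  fun p => (η (f p)).comp (mfderiv I I' f p)

/-- The local expression of a `1`-form in the preferred chart around `p`, i.e. its pullback by the
inverse of that chart. -/
def OneForm.local (η : OneForm I M) (p : M) : E → (E →L[ℝ] ℝ) :=
  fun y => (η ((extChartAt I p).symm y)).comp (mfderiv 𝓘(ℝ, E) I (extChartAt I p).symm y)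

/-- The exterior derivative `dη`, computed in the preferred chart around each point (for manifolds
without boundary): if `η̃` is the local expression of `η`, then
`dη(v, w) = (D η̃ · v) w - (D η̃ · w) v`, with `v` and `w` read in the chart. -/
def OneForm.extDeriv (η : OneForm I M) (p : M) (v w : TangentSpace I p) : ℝ :=
  let D : E →L[ℝ] (E →L[ℝ] ℝ) := fderiv ℝ (η.local p) (extChartAt I p p)
  let T : TangentSpace I p →L[ℝ] E := mfderiv I 𝓘(ℝ, E) (extChartAt I p) p
  D (T v) (T w) - D (T w) (T v)

/-- Up to a positive constant depending only on `n`, the value of `β ∧ ⋯ ∧ β ∧ α` (`n` factors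
`β`) on `2 n + 1` vectors, for a linear form `α` and an alternating bilinear form `β`. The vectors
are indexed by `none` (the slot of `α`) and the pairs `(i, 0)`, `(i, 1)` (the slots of the `i`-th
factor `β`), and one antisymmetrizes over all permutations of the slots. -/
def wedgePow {V : Type*} (n : ℕ) (β : V → V → ℝ) (α : V → ℝ)
    (v : Option (Fin n × Fin 2) → V) : ℝ :=
  ∑ s : Equiv.Perm (Option (Fin n × Fin 2)),
    ((Equiv.Perm.sign s : ℤ) : ℝ) *
      (α (v (s none)) * ∏ i : Fin n, β (v (s (some (i, 0)))) (v (s (some (i, 1)))))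

/-- `η` is a contact form on `M`: it is smooth, `dim M = 2 n + 1`, and
`(dη)^n ∧ η` vanishes nowhere. -/
def OneForm.IsContact [IsManifold I ∞ M] (η : OneForm I M) : Prop :=
  η.Smooth ∧ ∃ n : ℕ, Module.finrank ℝ E = 2 * n + 1 ∧
    ∀ p : M, ∃ v : Option (Fin n × Fin 2) → TangentSpace I p,
      wedgePow n (η.extDeriv p) (η p) v ≠ 0

/-- `f : (M, η) → (M', η')` is an anti-morphism of contact manifolds: both are contact manifolds,
`f` is smooth and `f^*η' = -η`. -/
structure IsContactAntimorphism [IsManifold I ∞ M] [IsManifold I' ∞ M']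
    (η : OneForm I M) (η' : OneForm I' M') (f : M → M') : Prop where
  source_contact : η.IsContact
  target_contact : η'.IsContact
  smooth : ContMDiff I I' ∞ f
  pullback_eq : ∀ p, η'.pullback I f p = -(η p)

/-- The canonical `1`-form of `T^*M`: `θ_α(v) = α(π_* v)`, where `π : T^*M → M`. -/
def canonicalOneForm (I : ModelWithCorners ℝ E H) (M : Type*) [TopologicalSpace M]
    [ChartedSpace H M] [IsManifold I ∞ M] : OneForm (cotangentModel I) (CotangentBundle I M) :=
  fun α => (α.2).comp
    (mfderiv (cotangentModel I) I (fun β : CotangentBundle I M => β.proj) α)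

/-- The `1`-form `p₁^*θ + c dz` on `T^*M × ℝ`, where `p₁` and `z` are the two projections, and `θ`
is the canonical `1`-form. -/
def canonicalContactForm (I : ModelWithCorners ℝ E H) (M : Type*) [TopologicalSpace M]
    [ChartedSpace H M] [IsManifold I ∞ M] (c : ℝ) :
    OneForm ((cotangentModel I).prod 𝓘(ℝ, ℝ)) (CotangentBundle I M × ℝ) :=
  fun a =>
    (canonicalOneForm I M).pullback ((cotangentModel I).prod 𝓘(ℝ, ℝ)) Prod.fst a +
      c • OneForm.ofFun ((cotangentModel I).prod 𝓘(ℝ, ℝ)) Prod.snd a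

end Forms

section HamiltonJacobi

variable {EM : Type*} [NormedAddCommGroup EM] [NormedSpace ℝ EM]
  {M : Type*} [TopologicalSpace M] [ChartedSpace EM M] [IsManifold 𝓘(ℝ, EM) ∞ M]
  {EN : Type*} [NormedAddCommGroup EN] [NormedSpace ℝ EN]
  {N : Type*} [TopologicalSpace N] [ChartedSpace EN N] [IsManifold 𝓘(ℝ, EN) ∞ N]
  {EL : Type*} [NormedAddCommGroup EL] [NormedSpace ℝ EL]
  {L : Type*} [TopologicalSpace L] [ChartedSpace EL L] [IsManifold 𝓘(ℝ, EL) ∞ L]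

variable (EN) in
/-- `σ` is a solution of the `Pr`-Hamilton-Jacobi equation for the vector field `X`: it is a smooth
section of `Pr : M → N` such that `σ_* ∘ Pr_* ∘ X ∘ σ = X ∘ σ`. -/
structure IsHJSolution (Pr : M → N) (X : (m : M) → TangentSpace 𝓘(ℝ, EM) m) (σ : N → M) :
    Prop where
  smooth : ContMDiff 𝓘(ℝ, EN) 𝓘(ℝ, EM) ∞ σ
  section_eq : ∀ p, Pr (σ p) = p
  hje : ∀ p, mfderiv 𝓘(ℝ, EN) 𝓘(ℝ, EM) σ (Pr (σ p))
      (mfderiv 𝓘(ℝ, EM) 𝓘(ℝ, EN) Pr (σ p) (X (σ p))) = X (σ p)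

variable (EN EL) in
/-- `S : N × L → M` is a complete solution of the `Pr`-Hamilton-Jacobi equation for `X`: it is a
surjective local diffeomorphism, all of whose partial maps `S (·, l)` are solutions. -/
structure IsCompleteSolution (Pr : M → N) (X : (m : M) → TangentSpace 𝓘(ℝ, EM) m)
    (S : N × L → M) : Prop where
  surjective : Function.Surjective S
  localDiffeo : IsLocalDiffeomorph (𝓘(ℝ, EN).prod 𝓘(ℝ, EL)) 𝓘(ℝ, EM) ∞ S
  partial_sol : ∀ l : L, IsHJSolution EN Pr X (fun p => S (p, l))

variable (EN) in
/-- `S` is pseudo-isotropic: `σ_l^*(dη) = 0` for every partial map `σ_l = S (·, l)`. -/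
def IsPseudoIsotropic (η : OneForm 𝓘(ℝ, EM) M) (S : N × L → M) : Prop :=
  ∀ (l : L) (p : N) (v w : TangentSpace 𝓘(ℝ, EN) p),
    η.extDeriv (S (p, l))
      (mfderiv 𝓘(ℝ, EN) 𝓘(ℝ, EM) (fun q => S (q, l)) p v)
      (mfderiv 𝓘(ℝ, EN) 𝓘(ℝ, EM) (fun q => S (q, l)) p w) = 0

variable (EN EL) in
/-- `W` is a smooth function on `N × L` whose partial functions `W_l = W (·, l)` are primitives of
the partial pullbacks: `σ_l^*η = dW_l` for all `l`, where `σ_l = S (·, l)`. -/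
structure IsPartialPrimitive (η : OneForm 𝓘(ℝ, EM) M) (S : N × L → M) (W : N × L → ℝ) :
    Prop where
  smooth : ContMDiff (𝓘(ℝ, EN).prod 𝓘(ℝ, EL)) 𝓘(ℝ, ℝ) ∞ W
  primitive : ∀ (l : L) (p : N),
    η.pullback 𝓘(ℝ, EN) (fun q => S (q, l)) p = OneForm.ofFun 𝓘(ℝ, EN) (fun q => W (q, l)) p

variable (EN EL) in
/-- The map `φ : N × L → T^*L` over the projection to `L` given by
`⟨φ(p, l), z⟩ = ⟨(dW - S^*η)(p, l), (0, z)⟩`. -/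
def phi (η : OneForm 𝓘(ℝ, EM) M) (S : N × L → M) (W : N × L → ℝ) (q : N × L) :
    CotangentBundle 𝓘(ℝ, EL) L :=
  ⟨q.2,
    (OneForm.ofFun (𝓘(ℝ, EN).prod 𝓘(ℝ, EL)) W q -
        η.pullback (𝓘(ℝ, EN).prod 𝓘(ℝ, EL)) S q :
      EN × EL →L[ℝ] ℝ).comp (ContinuousLinearMap.inr ℝ EN EL)⟩

end HamiltonJacobi

end ContactHJ

end

noncomputable section

namespace ContactHJ

open Filter Topology

section LocalForms

variable {E : Type*} [NormedAddCommGroup E] [NormedSpace ℝ E]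
  {H : Type*} [TopologicalSpace H] {I : ModelWithCorners ℝ E H}
  {M : Type*} [TopologicalSpace M] [ChartedSpace H M] [IsManifold I ∞ M]
  {E' : Type*} [NormedAddCommGroup E'] [NormedSpace ℝ E']
  {H' : Type*} [TopologicalSpace H'] {I' : ModelWithCorners ℝ E' H'}
  {M' : Type*} [TopologicalSpace M'] [ChartedSpace H' M'] [IsManifold I' ∞ M']

/-- A covector at `p`, read in the chart around `p₀`. -/
def covectorInChart (I : ModelWithCorners ℝ E H) {M : Type*} [TopologicalSpace M]
    [ChartedSpace H M] (p₀ p : M) (a : TangentSpace I p →L[ℝ] ℝ) : E →L[ℝ] ℝ :=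
  ContinuousLinearMap.comp (M₂ := E) a
    (mfderiv 𝓘(ℝ, E) I (extChartAt I p₀).symm (extChartAt I p₀ p))

theorem inCoordinates_covector [I.Boundaryless] {p₀ p : M} (hp : p ∈ (chartAt H p₀).source)
    (a : TangentSpace I p →L[ℝ] ℝ) :
    ContinuousLinearMap.inCoordinates E (TangentSpace I) ℝ (fun _ : M => ℝ) p₀ p p₀ p a =
      covectorInChart I p₀ p a := by
  have h := TangentBundle.symmL_trivializationAt (I := I) hp
  rw [I.range_eq_univ, mfderivWithin_univ] at h
  ext v
  have h' := DFunLike.congr_fun h v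
  have h₂ : ContinuousLinearMap.inCoordinates E (TangentSpace I) ℝ (fun _ : M => ℝ) p₀ p p₀ p a v =
      (Bundle.Trivial.trivialization M ℝ).continuousLinearMapAt ℝ p
        (a (Bundle.Trivialization.symmL ℝ (trivializationAt E (TangentSpace I) p₀) p v)) := rfl
  rw [h₂, Bundle.Trivial.continuousLinearMapAt_trivialization]
  exact congrArg a h'

omit [IsManifold I' ∞ M'] in
theorem contMDiffAt_cotangent_iff [I.Boundaryless] {n : WithTop ℕ∞}
    {f : M' → CotangentBundle I M} {k₀ : M'} :
    ContMDiffAt I' (cotangentModel I) n f k₀ ↔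
      ContMDiffAt I' I n (fun k => (f k).1) k₀ ∧
      ContMDiffAt I' 𝓘(ℝ, E →L[ℝ] ℝ) n
        (fun k => covectorInChart I (f k₀).1 (f k).1 (f k).2) k₀ := by
  refine (contMDiffAt_hom_bundle f).trans (and_congr_right fun h => ?_)
  refine EventuallyEq.contMDiffAt_iff ?_
  filter_upwards [h.continuousAt.preimage_mem_nhds
    ((chartAt H (f k₀).1).open_source.mem_nhds (mem_chart_source H _))] with k hk
  exact inCoordinates_covector hk _

theorem contMDiffAt_extChartAt_symm [I.Boundaryless] (p : M) {y : E}
    (hy : y ∈ (extChartAt I p).target) :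
    ContMDiffAt 𝓘(ℝ, E) I ∞ (extChartAt I p).symm y :=
  (contMDiffOn_extChartAt_symm p).contMDiffAt
    ((isOpen_extChartAt_target p).mem_nhds hy)

theorem OneForm.Smooth.contDiffAt_local [I.Boundaryless] {η : OneForm I M} (hη : η.Smooth)
    (p : M) : ContDiffAt ℝ ∞ (η.local p) (extChartAt I p p) := by
  have h := (contMDiffAt_cotangent_iff.1 (hη p)).2
  have h₁ := h.comp_of_eq (f := (extChartAt I p).symm) (x := extChartAt I p p)
    (contMDiffAt_extChartAt_symm p (mem_extChartAt_target p)) (extChartAt_to_inv p)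
  rw [contMDiffAt_iff_contDiffAt] at h₁
  refine h₁.congr_of_eventuallyEq ?_
  filter_upwards [extChartAt_target_mem_nhds (I := I) p] with y hy
  simp only [Function.comp_def, covectorInChart, OneForm.local]
  rw [(extChartAt I p).right_inv hy]
  rfl

section Pullback

variable {V : Type*} [NormedAddCommGroup V] [NormedSpace ℝ V]

/-- The pullback of a `1`-form to a normed space, as a function with values in the dual space. -/
def OneForm.pullbackVec (η : OneForm I M) (g : V → M) : V → V →L[ℝ] ℝ :=
  η.pullback 𝓘(ℝ, V) g

theorem OneForm.pullbackVec_eventuallyEq [I.Boundaryless] (η : OneForm I M) {g : V → M} {y : V}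
    (hg : ContMDiffAt 𝓘(ℝ, V) I ∞ g y) :
    (η.pullbackVec g) =ᶠ[𝓝 y] fun u =>
      (η.local (g y) (extChartAt I (g y) (g u))).comp
        (fderiv ℝ (fun u => extChartAt I (g y) (g u)) u) := by
  have h₁ : ∀ᶠ u in 𝓝 y, ContMDiffAt 𝓘(ℝ, V) I 1 g u :=
    contMDiffAt_iff_contMDiffAt_nhds (by simp) |>.1 (hg.of_le (by exact_mod_cast le_top))
  have h₂ : ∀ᶠ u in 𝓝 y, g u ∈ (extChartAt I (g y)).source :=
    hg.continuousAt.preimage_mem_nhds (extChartAt_source_mem_nhds (g y))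
  filter_upwards [h₁, h₂, h₂.eventually_nhds] with u hu₁ hu₂ hu₃
  have hκ : MDifferentiableAt 𝓘(ℝ, E) I (extChartAt I (g y)).symm (extChartAt I (g y) (g u)) :=
    (contMDiffAt_extChartAt_symm _ ((extChartAt I (g y)).map_source hu₂)).mdifferentiableAt
      (by simp)
  have hh : MDifferentiableAt 𝓘(ℝ, V) 𝓘(ℝ, E) (fun u => extChartAt I (g y) (g u)) u :=
    ((contMDiffAt_extChartAt' (n := ∞) (extChartAt_source I (g y) ▸ hu₂)).mdifferentiableAt
      (by simp)).comp u (hu₁.mdifferentiableAt (by simp))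
  have hgeq : g =ᶠ[𝓝 u] (extChartAt I (g y)).symm ∘ (fun u => extChartAt I (g y) (g u)) := by
    filter_upwards [hu₃] with u' hu'
    exact ((extChartAt I (g y)).left_inv hu').symm
  have hd := hgeq.mfderiv_eq (I := 𝓘(ℝ, V)) (I' := I)
  rw [mfderiv_comp u hκ hh, mfderiv_eq_fderiv] at hd
  ext v
  have hd' := DFunLike.congr_fun hd v
  have hp : (η (g u) : E →L[ℝ] ℝ) = η ((extChartAt I (g y)).symm (extChartAt I (g y) (g u))) := by
    rw [(extChartAt I (g y)).left_inv hu₂]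
  exact (congrArg (fun w : E => (η (g u) : E →L[ℝ] ℝ) w) hd').trans
    (congrArg (fun a : E →L[ℝ] ℝ => a _) hp)

omit [IsManifold I ∞ M] in
theorem contDiffAt_extChartAt_comp [I.Boundaryless] {g : V → M} {y : V}
    (hg : ContMDiffAt 𝓘(ℝ, V) I ∞ g y) :
    ContDiffAt ℝ ∞ (fun u => extChartAt I (g y) (g u)) y :=
  (contMDiffAt_extChartAt.comp y hg).contDiffAt

theorem OneForm.Smooth.contDiffAt_pullbackVec [I.Boundaryless] {η : OneForm I M} (hη : η.Smooth)
    {g : V → M} {y : V} (hg : ContMDiffAt 𝓘(ℝ, V) I ∞ g y) :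
    ContDiffAt ℝ ∞ (η.pullbackVec g) y := by
  refine ContDiffAt.congr_of_eventuallyEq ?_ (η.pullbackVec_eventuallyEq hg)
  have hh := contDiffAt_extChartAt_comp hg
  exact ((hη.contDiffAt_local (g y)).comp y hh).clm_comp (hh.fderiv_right (by simp))

theorem OneForm.Smooth.fderiv_pullbackVec_sub [I.Boundaryless] {η : OneForm I M} (hη : η.Smooth)
    {g : V → M} {y : V} (hg : ContMDiffAt 𝓘(ℝ, V) I ∞ g y) (v w : V) :
    fderiv ℝ (η.pullbackVec g) y v w -
      fderiv ℝ (η.pullbackVec g) y w v =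
      η.extDeriv (g y) (mfderiv 𝓘(ℝ, V) I g y v) (mfderiv 𝓘(ℝ, V) I g y w) := by
  have hh := contDiffAt_extChartAt_comp hg
  set h : V → E := fun u => extChartAt I (g y) (g u) with hdef
  have hl : DifferentiableAt ℝ (η.local (g y)) (h y) :=
    (hη.contDiffAt_local (g y)).differentiableAt (by simp)
  have hh₁ : DifferentiableAt ℝ h y := hh.differentiableAt (by simp)
  have hh₂ : DifferentiableAt ℝ (fderiv ℝ h) y :=
    (hh.fderiv_right (m := ∞) (by simp)).differentiableAt (by simp)
  have hT : ∀ v : V, mfderiv I 𝓘(ℝ, E) (extChartAt I (g y)) (g y) (mfderiv 𝓘(ℝ, V) I g y v) =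
      fderiv ℝ h y v := by
    intro v
    rw [← mfderiv_eq_fderiv]
    have := mfderiv_comp y (mdifferentiableAt_extChartAt (I := I) (mem_chart_source H (g y)))
      (hg.mdifferentiableAt (by simp))
    exact (DFunLike.congr_fun this v).symm
  have hs : fderiv ℝ (fderiv ℝ h) y v w = fderiv ℝ (fderiv ℝ h) y w v :=
    (hh.isSymmSndFDerivAt (by simpa using WithTop.coe_le_coe.2 (le_top : (2 : ℕ∞) ≤ ⊤))).eq v w
  have hlh : HasFDerivAt (fun u => η.local (g y) (h u))
      ((fderiv ℝ (η.local (g y)) (h y)).comp (fderiv ℝ h y)) y :=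
    hl.hasFDerivAt.comp y hh₁.hasFDerivAt
  have hD := hlh.clm_comp hh₂.hasFDerivAt
  have hD' := (hD.congr_of_eventuallyEq (η.pullbackVec_eventuallyEq hg)).fderiv
  have key : ∀ v w : V, fderiv ℝ (η.pullbackVec g) y v w =
      η.local (g y) (h y) (fderiv ℝ (fderiv ℝ h) y v w) +
        fderiv ℝ (η.local (g y)) (h y) (fderiv ℝ h y v) (fderiv ℝ h y w) := by
    intro v w
    refine (congrArg (fun A : V →L[ℝ] V →L[ℝ] ℝ => A v w) hD').trans ?_
    simp
  rw [key, key, hs]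
  simp only [OneForm.extDeriv]
  erw [hT, hT]
  simp only [hdef]
  ring

end Pullback

theorem OneForm.smooth_of_contDiffAt_local [I.Boundaryless] {η : OneForm I M}
    (h : ∀ p, ContDiffAt ℝ ∞ (η.local p) (extChartAt I p p)) : η.Smooth := by
  intro p
  refine contMDiffAt_cotangent_iff.2 ⟨contMDiffAt_id, ?_⟩
  have h₁ := (h p).contMDiffAt.comp p (contMDiffAt_extChartAt (I := I) (n := ∞))
  refine h₁.congr_of_eventuallyEq ?_
  filter_upwards [extChartAt_source_mem_nhds (I := I) p] with k hk
  simp only [Function.comp_def, covectorInChart, OneForm.local]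
  ext v
  have hp : (η k : E →L[ℝ] ℝ) = η ((extChartAt I p).symm (extChartAt I p k)) := by
    rw [(extChartAt I p).left_inv hk]
  exact congrArg (fun a : E →L[ℝ] ℝ => a (mfderiv 𝓘(ℝ, E) I (extChartAt I p).symm
    (extChartAt I p k) v)) hp

omit [IsManifold I ∞ M] in
theorem OneForm.local_pullback_eventuallyEq [I'.Boundaryless] (η : OneForm I M) {f : M' → M}
    (hf : ContMDiff I' I ∞ f) (p : M') :
    (η.pullback I' f).local p =ᶠ[𝓝 (extChartAt I' p p)]
      η.pullbackVec (f ∘ (extChartAt I' p).symm) := by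
  filter_upwards [extChartAt_target_mem_nhds (I := I') p] with y hy
  have := mfderiv_comp y (hf.mdifferentiableAt (x := (extChartAt I' p).symm y) (by simp))
    ((contMDiffAt_extChartAt_symm p hy).mdifferentiableAt (by simp))
  simp only [OneForm.pullbackVec, OneForm.pullback, OneForm.local]
  rw [this]
  rfl

theorem OneForm.Smooth.pullback [I.Boundaryless] [I'.Boundaryless] {η : OneForm I M}
    (hη : η.Smooth) {f : M' → M} (hf : ContMDiff I' I ∞ f) : (η.pullback I' f).Smooth :=
  OneForm.smooth_of_contDiffAt_local fun p =>
    (hη.contDiffAt_pullbackVec (hf.contMDiffAt.comp _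
      (contMDiffAt_extChartAt_symm p (mem_extChartAt_target p)))).congr_of_eventuallyEq
      (η.local_pullback_eventuallyEq hf p)

theorem OneForm.Smooth.extDeriv_pullback [I.Boundaryless] [I'.Boundaryless] {η : OneForm I M}
    (hη : η.Smooth) {f : M' → M} (hf : ContMDiff I' I ∞ f) (p : M') (v w : TangentSpace I' p) :
    (η.pullback I' f).extDeriv p v w =
      η.extDeriv (f p) (mfderiv I' I f p v) (mfderiv I' I f p w) := by
  have hs := contMDiffAt_extChartAt_symm (I := I') p (mem_extChartAt_target p)
  have hg : ContMDiffAt 𝓘(ℝ, E') I ∞ (f ∘ (extChartAt I' p).symm) (extChartAt I' p p) :=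
    hf.contMDiffAt.comp _ hs
  have hT : ∀ v : TangentSpace I' p, (mfderiv 𝓘(ℝ, E') I (f ∘ (extChartAt I' p).symm)
      (extChartAt I' p p) (mfderiv I' 𝓘(ℝ, E') (extChartAt I' p) p v) : E) =
        mfderiv I' I f p v := by
    intro v
    have h₁ := mfderiv_comp p (hg.mdifferentiableAt (by simp))
      (mdifferentiableAt_extChartAt (I := I') (mem_chart_source H' p))
    have h₂ : (f ∘ (extChartAt I' p).symm) ∘ (extChartAt I' p) =ᶠ[𝓝 p] f := by
      filter_upwards [extChartAt_source_mem_nhds (I := I') p] with k hk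
      exact congrArg f ((extChartAt I' p).left_inv hk)
    rw [h₂.mfderiv_eq] at h₁
    exact (DFunLike.congr_fun h₁ v).symm
  have h₃ := hη.fderiv_pullbackVec_sub hg (mfderiv I' 𝓘(ℝ, E') (extChartAt I' p) p v)
    (mfderiv I' 𝓘(ℝ, E') (extChartAt I' p) p w)
  have hp : (extChartAt I' p).symm (extChartAt I' p p) = p := extChartAt_to_inv p
  rw [← (η.local_pullback_eventuallyEq hf p).fderiv_eq] at h₃
  refine h₃.trans ?_
  have h₄ : ∀ q : M, q = f p → ∀ a b : E,
      OneForm.extDeriv η q (a : E) (b : E) = OneForm.extDeriv η (f p) (a : E) (b : E) := by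
    rintro q rfl a b; rfl
  refine (h₄ _ (by simp) _ _).trans ?_
  exact congrArg₂ (fun a b : E => OneForm.extDeriv η (f p) a b) (hT v) (hT w)

end LocalForms

section WedgePow

theorem sign_mul_prod_sign_of_pair_preserving {n : ℕ} (r : Equiv.Perm (Fin n × Fin 2))
    (hr : ∀ i, (r (i, 0)).1 = (r (i, 1)).1) :
    ((Equiv.Perm.sign r : ℤ) : ℝ) * ∏ i : Fin n, (if (r (i, 0)).2 = 0 then (1 : ℝ) else -1) = 1 := by
  have hr' : ∀ i k, (r (i, k)).1 = (r (i, 0)).1 := by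
    intro i k
    fin_cases k
    · rfl
    · exact (hr i).symm
  have hτ : ∀ i, Function.Bijective fun k => (r (i, k)).2 := by
    intro i
    refine Finite.injective_iff_bijective.1 fun k l hkl => ?_
    have : r (i, k) = r (i, l) := Prod.ext ((hr' i k).trans (hr' i l).symm) hkl
    simpa using r.injective this
  let τ : Fin n → Equiv.Perm (Fin 2) := fun i => Equiv.ofBijective _ (hτ i)
  have hπ : Function.Bijective fun i => (r (i, 0)).1 := by
    refine Finite.injective_iff_bijective.1 fun i j hij => ?_
    obtain ⟨k, hk⟩ := (hτ i).2 (r (j, 0)).2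
    have : r (i, k) = r (j, 0) := Prod.ext ((hr' i k).trans hij) hk
    exact (Prod.ext_iff.1 (r.injective this)).1
  let ρ : Equiv.Perm (Fin n) := Equiv.ofBijective _ hπ
  have hdec : r = Equiv.prodCongrLeft (fun _ : Fin 2 => ρ) * Equiv.prodCongrRight τ := by
    ext1 ⟨i, k⟩
    exact Prod.ext (hr' i k) rfl
  have hsign : Equiv.Perm.sign r = ∏ i, Equiv.Perm.sign (τ i) := by
    rw [hdec, map_mul, Equiv.Perm.sign_prodCongrLeft, Equiv.Perm.sign_prodCongrRight]
    simp
  have hfin : ∀ t : Equiv.Perm (Fin 2), (Equiv.Perm.sign t : ℤ) = if t 0 = 0 then 1 else -1 := by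
    decide
  rw [hsign, Units.coe_prod, Int.cast_prod, ← Finset.prod_mul_distrib]
  refine Finset.prod_eq_one fun i _ => ?_
  rw [hfin (τ i)]
  change (((if (r (i, 0)).2 = 0 then 1 else -1 : ℤ)) : ℝ) * _ = 1
  split_ifs <;> simp

theorem wedgePow_ne_zero_of_darboux {V : Type*} {n : ℕ} {β : V → V → ℝ} {α : V → ℝ}
    {v : Option (Fin n × Fin 2) → V} (hα : α (v none) ≠ 0)
    (hl : ∀ k, β (v none) (v k) = 0) (hr : ∀ k, β (v k) (v none) = 0)
    (h₀ : ∀ i j, β (v (some (i, 0))) (v (some (j, 0))) = 0)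
    (h₁ : ∀ i j, β (v (some (i, 1))) (v (some (j, 1))) = 0)
    (h₀₁ : ∀ i j, β (v (some (i, 0))) (v (some (j, 1))) = if i = j then 1 else 0)
    (h₁₀ : ∀ i j, β (v (some (i, 1))) (v (some (j, 0))) = -(if i = j then 1 else 0)) :
    wedgePow n β α v ≠ 0 := by
  have hβ : ∀ a b : Fin n × Fin 2, a.1 ≠ b.1 → β (v (some a)) (v (some b)) = 0 := by
    rintro ⟨i, k⟩ ⟨j, l⟩ hij
    fin_cases k <;> fin_cases l <;> simp_all
  have hβ' : ∀ a b : Fin n × Fin 2, a.1 = b.1 → a ≠ b →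
      β (v (some a)) (v (some b)) = if a.2 = 0 then 1 else -1 := by
    rintro ⟨i, k⟩ ⟨j, l⟩ hij hne
    fin_cases k <;> fin_cases l <;> simp_all
  have hterm : ∀ s : Equiv.Perm (Option (Fin n × Fin 2)), ∃ t : ℝ, 0 ≤ t ∧ (s = 1 → t = 1) ∧
      ((Equiv.Perm.sign s : ℤ) : ℝ) *
        (α (v (s none)) * ∏ i : Fin n, β (v (s (some (i, 0)))) (v (s (some (i, 1))))) =
        α (v none) * t := by
    intro s
    by_cases hs : s none = none
    · obtain ⟨r, rfl⟩ : ∃ r : Equiv.Perm (Fin n × Fin 2), s = Equiv.optionCongr r := by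
        refine ⟨Equiv.removeNone s, ?_⟩
        ext1 x
        cases x with
        | none => simpa using hs
        | some x =>
          have := Equiv.removeNone_some s (x := x) (by
            rcases h : s (some x) with _ | y
            · exact absurd (s.injective (h.trans hs.symm)) (by simp)
            · exact ⟨y, rfl⟩)
          exact this.symm
      by_cases hp : ∀ i, (r (i, 0)).1 = (r (i, 1)).1
      · refine ⟨1, zero_le_one, fun _ => rfl, ?_⟩
        have h := sign_mul_prod_sign_of_pair_preserving r hp
        have : ∀ i, β (v (some (r (i, 0)))) (v (some (r (i, 1)))) =
            if (r (i, 0)).2 = 0 then 1 else -1 := fun i =>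
          hβ' _ _ (hp i) fun h => by simpa using r.injective h
        simp only [Equiv.optionCongr_sign, Equiv.optionCongr_apply, Option.map_none,
          Option.map_some, this]
        linear_combination α (v none) * h
      · push Not at hp
        obtain ⟨i, hi⟩ := hp
        refine ⟨0, le_rfl, ?_, ?_⟩
        · intro h
          have h' := fun x => DFunLike.congr_fun h (some x)
          simp only [Equiv.optionCongr_apply, Option.map_some, Equiv.Perm.coe_one, id_eq,
            Option.some.injEq] at h'
          simp [h'] at hi
        · rw [Finset.prod_eq_zero (Finset.mem_univ i)]
          · simp
          · exact hβ _ _ hi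
    · refine ⟨0, le_rfl, fun h => absurd (by simp [h]) hs, ?_⟩
      obtain ⟨x, hx⟩ := s.surjective none
      rcases x with _ | ⟨i, k⟩
      · exact absurd hx hs
      rw [Finset.prod_eq_zero (Finset.mem_univ i)]
      · simp
      · fin_cases k
        · simp only [Fin.zero_eta] at hx
          rw [hx, hl]
        · simp only [Fin.mk_one] at hx
          rw [hx, hr]
  choose t ht₀ ht₁ ht using hterm
  rw [wedgePow, Finset.sum_congr rfl fun s _ => ht s, ← Finset.mul_sum]
  refine mul_ne_zero hα (ne_of_gt ?_)
  exact Finset.sum_pos' (fun s _ => ht₀ s) ⟨1, Finset.mem_univ _, by simp [ht₁ 1 rfl]⟩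

end WedgePow

section CanonicalForm

variable {E : Type*} [NormedAddCommGroup E] [NormedSpace ℝ E]
  {H : Type*} [TopologicalSpace H] {I : ModelWithCorners ℝ E H}
  {M : Type*} [TopologicalSpace M] [ChartedSpace H M] [IsManifold I ∞ M]
  {E' : Type*} [NormedAddCommGroup E'] [NormedSpace ℝ E']
  {H' : Type*} [TopologicalSpace H'] {I' : ModelWithCorners ℝ E' H'}
  {M' : Type*} [TopologicalSpace M'] [ChartedSpace H' M']

theorem mdifferentiableAt_cotangent_proj (a : CotangentBundle I M) :
    MDifferentiableAt (cotangentModel I) I (fun β : CotangentBundle I M => β.proj) a :=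
  (Bundle.contMDiff_proj (n := 1) (IB := I)
    (fun p : M => TangentSpace I p →L[ℝ] ℝ)).mdifferentiableAt (by simp)

theorem canonicalContactForm_pullback_apply (c : ℝ) {F : M' → CotangentBundle I M × ℝ} {k : M'}
    (hF : MDifferentiableAt I' ((cotangentModel I).prod 𝓘(ℝ, ℝ)) F k) (v : TangentSpace I' k) :
    (canonicalContactForm I M c).pullback I' F k v =
      (F k).1.2 (mfderiv I' I (fun k => (F k).1.proj) k v) +
        c * OneForm.ofFun I' (fun k => (F k).2) k v := by
  have h₁ : mfderiv I' I (fun k => (F k).1.proj) k v =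
      mfderiv (cotangentModel I) I (fun β : CotangentBundle I M => β.proj) (F k).1
        (mfderiv ((cotangentModel I).prod 𝓘(ℝ, ℝ)) (cotangentModel I) Prod.fst (F k)
          (mfderiv I' ((cotangentModel I).prod 𝓘(ℝ, ℝ)) F k v)) := by
    have e₁ := mfderiv_comp k (mdifferentiableAt_cotangent_proj (F k).1)
      (mdifferentiableAt_fst.comp k hF)
    have e₂ := mfderiv_comp (I' := (cotangentModel I).prod 𝓘(ℝ, ℝ)) (I'' := cotangentModel I) k
      (mdifferentiableAt_fst (x := F k)) hF
    rw [e₂] at e₁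
    exact DFunLike.congr_fun e₁ v
  have h₂ : mfderiv I' 𝓘(ℝ, ℝ) (fun k => (F k).2) k v =
      mfderiv ((cotangentModel I).prod 𝓘(ℝ, ℝ)) 𝓘(ℝ, ℝ) Prod.snd (F k)
        (mfderiv I' ((cotangentModel I).prod 𝓘(ℝ, ℝ)) F k v) := by
    have e₂ := mfderiv_comp (I' := (cotangentModel I).prod 𝓘(ℝ, ℝ)) (I'' := 𝓘(ℝ, ℝ)) k
      (mdifferentiableAt_snd (x := F k)) hF
    exact DFunLike.congr_fun e₂ v
  rw [h₁]
  exact congrArg (fun r : ℝ => _ + c * r) h₂.symm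

/-- The `1`-form `ξ dq + c dz` on a normed space `W`, where `q`, `ξ` and `z` are linear functions
on `W` with values in `E`, in its dual, and in `ℝ`. -/
def darbouxForm {W : Type*} [NormedAddCommGroup W] [NormedSpace ℝ W] (q : W →L[ℝ] E)
    (ξ : W →L[ℝ] E →L[ℝ] ℝ) (z : W →L[ℝ] ℝ) (c : ℝ) (y : W) : W →L[ℝ] ℝ :=
  (ξ y).comp q + c • z

section

variable {W : Type*} [NormedAddCommGroup W] [NormedSpace ℝ W] (q : W →L[ℝ] E)
    (ξ : W →L[ℝ] E →L[ℝ] ℝ) (z : W →L[ℝ] ℝ) (c : ℝ)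

theorem fderiv_darbouxForm (y v w : W) :
    fderiv ℝ (darbouxForm q ξ z c) y v w = ξ v (q w) := by
  have h : HasFDerivAt (darbouxForm q ξ z c)
      (((ContinuousLinearMap.compL ℝ W E ℝ).flip q).comp ξ) y :=
    (ContinuousLinearMap.hasFDerivAt (((ContinuousLinearMap.compL ℝ W E ℝ).flip q).comp ξ)).add_const
      (c • z)
  rw [h.fderiv]
  rfl

theorem contDiff_darbouxForm : ContDiff ℝ ∞ (darbouxForm q ξ z c) :=
  (ContinuousLinearMap.contDiff (((ContinuousLinearMap.compL ℝ W E ℝ).flip q).comp ξ)).add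
    contDiff_const

end

/-- The canonical contact form in cotangent coordinates `((q, ξ), z)`: `ξ dq + c dz`. -/
abbrev canonicalContactModel (E : Type*) [NormedAddCommGroup E] [NormedSpace ℝ E] (c : ℝ) :
    (E × (E →L[ℝ] ℝ)) × ℝ → ((E × (E →L[ℝ] ℝ)) × ℝ) →L[ℝ] ℝ :=
  darbouxForm ((ContinuousLinearMap.fst ℝ E (E →L[ℝ] ℝ)).comp
    (ContinuousLinearMap.fst ℝ (E × (E →L[ℝ] ℝ)) ℝ))
    ((ContinuousLinearMap.snd ℝ E (E →L[ℝ] ℝ)).comp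
      (ContinuousLinearMap.fst ℝ (E × (E →L[ℝ] ℝ)) ℝ))
    (ContinuousLinearMap.snd ℝ (E × (E →L[ℝ] ℝ)) ℝ) c

theorem cotangent_extChartAt_apply [I.Boundaryless] (α : CotangentBundle I M)
    {β : CotangentBundle I M} (hβ : β.proj ∈ (chartAt H α.proj).source) :
    extChartAt (cotangentModel I) α β =
      (extChartAt I α.proj β.proj, covectorInChart I α.proj β.proj β.2) := by
  rw [← inCoordinates_covector hβ]
  have h := FiberBundle.extChartAt (IB := I) α
  rw [h]
  rfl

theorem cotangent_extChartAt_symm [I.Boundaryless] (α : CotangentBundle I M)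
    {y : E × (E →L[ℝ] ℝ)} (hy : y ∈ (extChartAt (cotangentModel I) α).target) :
    y.1 ∈ (extChartAt I α.proj).target ∧
    ((extChartAt (cotangentModel I) α).symm y).proj = (extChartAt I α.proj).symm y.1 ∧
    ∀ v : E, (((extChartAt (cotangentModel I) α).symm y).2 : E →L[ℝ] ℝ)
      (mfderiv 𝓘(ℝ, E) I (extChartAt I α.proj).symm y.1 v : E) = y.2 v := by
  have hβ : ((extChartAt (cotangentModel I) α).symm y).proj ∈ (chartAt H α.proj).source := by
    have h := (extChartAt (cotangentModel I) α).map_target hy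
    rw [FiberBundle.extChartAt, PartialEquiv.trans_source] at h
    have h' := h.1
    exact ((Bundle.Trivialization.mem_source _).1 h').1
  have h := cotangent_extChartAt_apply α hβ
  rw [(extChartAt (cotangentModel I) α).right_inv hy] at h
  have h₁ := congrArg Prod.fst h
  have h₂ := congrArg Prod.snd h
  rw [← extChartAt_source (I := I)] at hβ
  refine ⟨?_, ?_, fun v => ?_⟩
  · rw [h₁]; exact (extChartAt I α.proj).map_source hβ
  · rw [h₁]; exact ((extChartAt I α.proj).left_inv hβ).symm
  · simp only at h₁ h₂
    rw [h₂, h₁]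
    rfl

theorem canonicalContactForm_local_eventuallyEq [I.Boundaryless] (c : ℝ)
    (a : CotangentBundle I M × ℝ) :
    (canonicalContactForm I M c).local a
      =ᶠ[𝓝 (extChartAt ((cotangentModel I).prod 𝓘(ℝ, ℝ)) a a)] canonicalContactModel E c := by
  have hO := isOpen_extChartAt_target (I := (cotangentModel I).prod 𝓘(ℝ, ℝ)) a
  filter_upwards [extChartAt_target_mem_nhds (I := (cotangentModel I).prod 𝓘(ℝ, ℝ)) a] with y hy
  have hF : MDifferentiableAt 𝓘(ℝ, (E × (E →L[ℝ] ℝ)) × ℝ) ((cotangentModel I).prod 𝓘(ℝ, ℝ))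
      (extChartAt ((cotangentModel I).prod 𝓘(ℝ, ℝ)) a).symm y :=
    (contMDiffAt_extChartAt_symm a hy).mdifferentiableAt (by simp)
  have hpr : ∀ u : (E × (E →L[ℝ] ℝ)) × ℝ,
      (extChartAt ((cotangentModel I).prod 𝓘(ℝ, ℝ)) a).symm u =
        ((extChartAt (cotangentModel I) a.1).symm u.1, u.2) := by
    intro u
    rw [extChartAt_prod]
    rfl
  have hmem : ∀ u ∈ (extChartAt ((cotangentModel I).prod 𝓘(ℝ, ℝ)) a).target,
      u.1 ∈ (extChartAt (cotangentModel I) a.1).target := by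
    intro u hu
    rw [extChartAt_prod] at hu
    exact hu.1
  have hs := cotangent_extChartAt_symm a.1 (hmem y hy)
  have hκ : MDifferentiableAt 𝓘(ℝ, E) I (extChartAt I a.1.proj).symm y.1.1 :=
    (contMDiffAt_extChartAt_symm _ hs.1).mdifferentiableAt (by simp)
  have e₁ : (fun u => ((extChartAt ((cotangentModel I).prod 𝓘(ℝ, ℝ)) a).symm u).1.proj) =ᶠ[𝓝 y]
      (extChartAt I a.1.proj).symm ∘ ((ContinuousLinearMap.fst ℝ E (E →L[ℝ] ℝ)).comp
          (ContinuousLinearMap.fst ℝ (E × (E →L[ℝ] ℝ)) ℝ)) := by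
    filter_upwards [hO.mem_nhds hy] with u hu
    rw [hpr u]
    exact (cotangent_extChartAt_symm a.1 (hmem u hu)).2.1
  have e₂ : (fun u => ((extChartAt ((cotangentModel I).prod 𝓘(ℝ, ℝ)) a).symm u).2) =
      ContinuousLinearMap.snd ℝ (E × (E →L[ℝ] ℝ)) ℝ := by
    ext1 u
    rw [hpr u]
    rfl
  refine ContinuousLinearMap.ext fun v => ?_
  refine (canonicalContactForm_pullback_apply c hF v).trans ?_
  have d₁ := mfderiv_comp y hκ (((ContinuousLinearMap.fst ℝ E (E →L[ℝ] ℝ)).comp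
    (ContinuousLinearMap.fst ℝ (E × (E →L[ℝ] ℝ)) ℝ)).mdifferentiableAt (x := y))
  rw [← e₁.mfderiv_eq, ContinuousLinearMap.mfderiv_eq] at d₁
  have d₂ : OneForm.ofFun 𝓘(ℝ, (E × (E →L[ℝ] ℝ)) × ℝ)
      (fun u => ((extChartAt ((cotangentModel I).prod 𝓘(ℝ, ℝ)) a).symm u).2) y v = v.2 := by
    rw [e₂, OneForm.ofFun, ContinuousLinearMap.mfderiv_eq]
    rfl
  rw [d₂]
  have d₁' := DFunLike.congr_fun d₁ v
  refine congrArg (fun r : ℝ => r + c * v.2) (Eq.trans ?_ (hs.2.2 v.1.1))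
  have hβ : ∀ (p₁ p₂ : CotangentBundle I M × ℝ), p₁ = p₂ → ∀ w : E,
      (p₁.1.2 : E →L[ℝ] ℝ) w = (p₂.1.2 : E →L[ℝ] ℝ) w := by
    rintro p₁ _ rfl w; rfl
  exact (congrArg (fun w : E =>
    (((extChartAt ((cotangentModel I).prod 𝓘(ℝ, ℝ)) a).symm y).1.2 : E →L[ℝ] ℝ) w) d₁').trans
    (hβ _ _ (hpr y) _)

theorem canonicalContactForm_smooth [I.Boundaryless] (c : ℝ) :
    (canonicalContactForm I M c).Smooth :=
  OneForm.smooth_of_contDiffAt_local fun p =>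
    (contDiff_darbouxForm _ _ _ c).contDiffAt.congr_of_eventuallyEq
      (canonicalContactForm_local_eventuallyEq c p)

theorem canonicalContactForm_extDeriv [I.Boundaryless] (c : ℝ)
    (a : CotangentBundle I M × ℝ) (v w : (E × (E →L[ℝ] ℝ)) × ℝ) :
    (canonicalContactForm I M c).extDeriv a v w = v.1.2 w.1.1 - w.1.2 v.1.1 := by
  simp only [OneForm.extDeriv]
  rw [mfderiv_extChartAt_self, (canonicalContactForm_local_eventuallyEq c a).fderiv_eq]
  exact congrArg₂ _ (fderiv_darbouxForm _ _ _ c _ _ _) (fderiv_darbouxForm _ _ _ c _ _ _)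

theorem canonicalContactForm_apply_vertical (c : ℝ) (a : CotangentBundle I M × ℝ) (t : ℝ) :
    canonicalContactForm I M c a ((0, t) : (E × (E →L[ℝ] ℝ)) × ℝ) = c * t := by
  have h₁ : (mfderiv ((cotangentModel I).prod 𝓘(ℝ, ℝ)) (cotangentModel I) Prod.fst a
      ((0, t) : (E × (E →L[ℝ] ℝ)) × ℝ) : E × (E →L[ℝ] ℝ)) = 0 := by
    rw [mfderiv_fst]
    rfl
  have h₂ : (mfderiv ((cotangentModel I).prod 𝓘(ℝ, ℝ)) 𝓘(ℝ, ℝ) Prod.snd a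
      ((0, t) : (E × (E →L[ℝ] ℝ)) × ℝ) : ℝ) = t := by
    rw [mfderiv_snd]
    rfl
  have h₃ : ∀ w : E × (E →L[ℝ] ℝ), w = 0 → canonicalOneForm I M a.1 w = 0 := by
    rintro _ rfl
    exact map_zero (canonicalOneForm I M a.1)
  have h₄ := congrArg₂ (fun r s : ℝ => r + c * s) (h₃ _ h₁) h₂
  exact h₄.trans (zero_add _)

theorem canonicalContactForm_isContact [I.Boundaryless] [FiniteDimensional ℝ E] {c : ℝ}
    (hc : c ≠ 0) : (canonicalContactForm I M c).IsContact := by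
  refine ⟨canonicalContactForm_smooth c, Module.finrank ℝ E, ?_, fun a => ?_⟩
  · have : Module.finrank ℝ (E →L[ℝ] ℝ) = Module.finrank ℝ E :=
      (LinearMap.toContinuousLinearMap (𝕜 := ℝ) (E := E) (F' := ℝ)).finrank_eq.symm.trans
        Subspace.dual_finrank_eq
    rw [Module.finrank_prod, Module.finrank_prod, Module.finrank_self, this]
    ring
  · let b := Module.finBasis ℝ E
    let v : Option (Fin (Module.finrank ℝ E) × Fin 2) → (E × (E →L[ℝ] ℝ)) × ℝ := fun k =>
      k.elim ((0, 0), 1) fun ik =>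
        if ik.2 = 0 then ((0, LinearMap.toContinuousLinearMap (b.coord ik.1)), 0) else
          ((b ik.1, 0), 0)
    refine ⟨v, wedgePow_ne_zero_of_darboux ?_ ?_ ?_ ?_ ?_ ?_ ?_⟩
    · rw [show v none = ((0, 0), 1) from rfl]
      erw [canonicalContactForm_apply_vertical]
      simpa using hc
    all_goals
      intros
      erw [canonicalContactForm_extDeriv]
      simp [v, Finsupp.single_apply, eq_comm]

end CanonicalForm

section ParametricIntegral

open Set

variable {E : Type*} [NormedAddCommGroup E] [NormedSpace ℝ E]

theorem hasFDerivAt_partial_left {f : E → ℝ → ℝ} {x : E} {t : ℝ}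
    (hf : DifferentiableAt ℝ (fun p : E × ℝ => f p.1 p.2) (x, t)) :
    HasFDerivAt (fun x => f x t) ((fderiv ℝ (fun p : E × ℝ => f p.1 p.2) (x, t)).comp
      (ContinuousLinearMap.inl ℝ E ℝ)) x :=
  hf.hasFDerivAt.comp (f := fun x => (x, t)) x (hasFDerivAt_prodMk_left x t)

theorem eventually_fderiv_partial_left {f : E → ℝ → ℝ} {x : E} {t : ℝ}
    (hf : ContDiffAt ℝ 1 (fun p : E × ℝ => f p.1 p.2) (x, t)) :
    ∀ᶠ p : E × ℝ in 𝓝 (x, t), fderiv ℝ (fun x => f x p.2) p.1 =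
      (fderiv ℝ (fun p : E × ℝ => f p.1 p.2) p).comp (ContinuousLinearMap.inl ℝ E ℝ) := by
  filter_upwards [hf.eventually (by simp)] with p hp
  exact (hasFDerivAt_partial_left (hp.differentiableAt (by simp))).fderiv

theorem continuousOn_fderiv_partial_left {s : Set E} {f : E → ℝ → ℝ}
    (hf : ∀ x ∈ s, ∀ t ∈ Icc (0 : ℝ) 1, ContDiffAt ℝ 1 (fun p : E × ℝ => f p.1 p.2) (x, t)) :
    ContinuousOn (fun p : E × ℝ => fderiv ℝ (fun x => f x p.2) p.1) (s ×ˢ Icc 0 1) := by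
  rintro ⟨x, t⟩ ⟨hx, ht⟩
  refine ContinuousAt.continuousWithinAt ?_
  refine ContinuousAt.congr ?_ (EventuallyEq.symm (eventually_fderiv_partial_left (hf x hx t ht)))
  exact ((hf x hx t ht).fderiv_right (m := 0) (by simp)).continuousAt.clm_comp continuousAt_const

theorem intervalIntegrable_fderiv_partial_left {s : Set E} {f : E → ℝ → ℝ}
    (hf : ∀ x ∈ s, ∀ t ∈ Icc (0 : ℝ) 1, ContDiffAt ℝ 1 (fun p : E × ℝ => f p.1 p.2) (x, t))
    {x : E} (hx : x ∈ s) :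
    IntervalIntegrable (fun t => fderiv ℝ (fun x => f x t) x) MeasureTheory.volume 0 1 := by
  refine ContinuousOn.intervalIntegrable ?_
  rw [uIcc_of_le zero_le_one]
  exact (continuousOn_fderiv_partial_left hf).comp (f := fun t : ℝ => (x, t)) (by fun_prop)
    fun t ht => ⟨hx, ht⟩

theorem hasFDerivAt_parametric_integral [FiniteDimensional ℝ E] {s : Set E} (hs : IsOpen s)
    {f : E → ℝ → ℝ}
    (hf : ∀ x ∈ s, ∀ t ∈ Icc (0 : ℝ) 1, ContDiffAt ℝ 1 (fun p : E × ℝ => f p.1 p.2) (x, t))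
    {x : E} (hx : x ∈ s) :
    HasFDerivAt (fun x => ∫ t in (0 : ℝ)..1, f x t)
      (∫ t in (0 : ℝ)..1, fderiv ℝ (fun x => f x t) x) x := by
  have : ProperSpace E := FiniteDimensional.proper ℝ E
  obtain ⟨K, hK, hxK, hKs⟩ := exists_compact_subset hs hx
  obtain ⟨C, hC⟩ := (hK.prod (isCompact_Icc (a := (0 : ℝ)) (b := 1))).exists_bound_of_continuousOn
    ((continuousOn_fderiv_partial_left hf).mono (prod_mono_left hKs))
  have hcont : ∀ y ∈ s, ContinuousOn (f y) (uIcc 0 1) := by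
    intro y hy t ht
    rw [uIcc_of_le zero_le_one] at ht
    exact ((hf y hy t ht).continuousAt.comp (f := fun t : ℝ => (y, t))
      (by fun_prop)).continuousWithinAt
  have hI : uIoc (0 : ℝ) 1 ⊆ Icc 0 1 := by
    rw [uIoc_of_le zero_le_one]
    exact Ioc_subset_Icc_self
  refine intervalIntegral.hasFDerivAt_integral_of_dominated_of_fderiv_le (bound := fun _ => C)
    (F' := fun x t => fderiv ℝ (fun x => f x t) x) (s := K)
    (mem_interior_iff_mem_nhds.1 hxK) ?_ (hcont x hx).intervalIntegrable
    (intervalIntegrable_iff.1 (intervalIntegrable_fderiv_partial_left hf hx)).aestronglyMeasurable ?_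
    intervalIntegrable_const ?_
  · filter_upwards [hs.mem_nhds hx] with y hy
    exact (intervalIntegrable_iff.1 (hcont y hy).intervalIntegrable).aestronglyMeasurable
  · exact Eventually.of_forall fun t ht y hy => hC (y, t) ⟨hy, hI ht⟩
  · exact Eventually.of_forall fun t ht y hy => (hasFDerivAt_partial_left
      ((hf y (hKs hy) t (hI ht)).differentiableAt (by simp))).differentiableAt.hasFDerivAt

theorem contDiffOn_parametric_integral [FiniteDimensional ℝ E] {s : Set E} (hs : IsOpen s)
    {f : E → ℝ → ℝ}
    (hf : ∀ x ∈ s, ∀ t ∈ Icc (0 : ℝ) 1, ContDiffAt ℝ ∞ (fun p : E × ℝ => f p.1 p.2) (x, t)) :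
    ContDiffOn ℝ ∞ (fun x => ∫ t in (0 : ℝ)..1, f x t) s := by
  refine contDiffOn_infty.2 fun n => ?_
  induction n generalizing f with
  | zero =>
    refine contDiffOn_zero.2 fun x hx => ?_
    exact (hasFDerivAt_parametric_integral hs (fun x hx t ht => (hf x hx t ht).of_le
      (by simp)) hx).continuousAt.continuousWithinAt
  | succ n ih =>
    have hf₁ : ∀ x ∈ s, ∀ t ∈ Icc (0 : ℝ) 1,
        ContDiffAt ℝ 1 (fun p : E × ℝ => f p.1 p.2) (x, t) :=
      fun x hx t ht => (hf x hx t ht).of_le (by simp)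
    refine contDiffOn_succ_of_fderiv_apply (n := (n : WithTop ℕ∞)) ?_ ?_ fun y => ?_
    · exact fun x hx =>
        (hasFDerivAt_parametric_integral hs hf₁ hx).differentiableAt.differentiableWithinAt
    · simp
    · refine (ih (f := fun x t => fderiv ℝ (fun x => f x t) x y) fun x hx t ht => ?_).congr
        fun x hx => ?_
      · refine ContDiffAt.congr_of_eventuallyEq ?_
          ((eventually_fderiv_partial_left (hf₁ x hx t ht)).mono fun p hp =>
            DFunLike.congr_fun hp y)
        exact (((hf x hx t ht).fderiv_right (m := ∞) (by simp)).clm_comp contDiffAt_const).clm_apply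
          contDiffAt_const
      · rw [fderivWithin_of_isOpen hs hx, (hasFDerivAt_parametric_integral hs hf₁ hx).fderiv]
        exact ContinuousLinearMap.intervalIntegral_apply
          (intervalIntegrable_fderiv_partial_left hf₁ hx) y

end ParametricIntegral

section Poincare

open Set

variable {E : Type*} [NormedAddCommGroup E] [NormedSpace ℝ E]
  {P : Type*} [NormedAddCommGroup P] [NormedSpace ℝ P]

/-- The integral of a `1`-form along the segment from `c` to `y`. -/
def segmentPrimitive (β : E → E →L[ℝ] ℝ) (c y : E) : ℝ :=
  ∫ t in (0 : ℝ)..1, β (AffineMap.lineMap c y t) (y - c)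

theorem hasFDerivAt_segmentPrimitive {s : Set E} (hs : IsOpen s) (hs' : Convex ℝ s)
    {β : E → E →L[ℝ] ℝ} (hβ : ∀ y ∈ s, DifferentiableAt ℝ β y)
    (hsymm : ∀ y ∈ s, ∀ v w, fderiv ℝ β y v w = fderiv ℝ β y w v) {c y : E} (hc : c ∈ s)
    (hy : y ∈ s) : HasFDerivAt (segmentPrimitive β c) (β y) y := by
  have h := hs'.hasFDerivWithinAt_curveIntegral_segment_of_hasFDerivWithinAt_symmetric
    (show ∀ x ∈ s, HasFDerivWithinAt β (fderiv ℝ β x) s x from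
      fun x hx => (hβ x hx).hasFDerivAt.hasFDerivWithinAt)
    (fun a ha v _ w _ => hsymm a ha v w) hc hy
  refine (h.hasFDerivAt (hs.mem_nhds hy)).congr_of_eventuallyEq (Eventually.of_forall fun z => ?_)
  simp only [segmentPrimitive, curveIntegral_segment]

theorem contDiffOn_segmentPrimitive [FiniteDimensional ℝ E] [FiniteDimensional ℝ P]
    {s : Set E} (hs : IsOpen s) (hs' : Convex ℝ s) {T : Set P} (hT : IsOpen T)
    {α : E × P → E →L[ℝ] ℝ} (hα : ∀ p ∈ s ×ˢ T, ContDiffAt ℝ ∞ α p) {c : E} (hc : c ∈ s) :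
    ContDiffOn ℝ ∞ (fun p : E × P => segmentPrimitive (fun y => α (y, p.2)) c p.1) (s ×ˢ T) := by
  refine contDiffOn_parametric_integral (hs.prod hT)
    (f := fun (p : E × P) (t : ℝ) => α (AffineMap.lineMap c p.1 t, p.2) (p.1 - c))
    fun p hp t ht => ?_
  have h₁ : ContDiffAt ℝ ∞ (fun q : (E × P) × ℝ => (AffineMap.lineMap c q.1.1 q.2, q.1.2)) (p, t) := by
    simp only [AffineMap.lineMap_apply_module]
    fun_prop
  refine ContDiffAt.clm_apply (ContDiffAt.comp (g := α) (p, t) ?_ h₁) (by fun_prop)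
  exact hα _ ⟨hs'.lineMap_mem hc hp.1 ht, hp.2⟩

end Poincare

section Gluing

open Set

/-- The covering (a fiber bundle with discrete fiber `A`) whose continuous sections are the functions
that differ from each `f i` by a locally constant function on `U i`. -/
def primitiveBundle {X ι A : Type*} [TopologicalSpace X] [AddCommGroup A] [TopologicalSpace A]
    [DiscreteTopology A] (U : ι → Set X) (hU : ∀ i, IsOpen (U i)) (idx : X → ι)
    (hidx : ∀ x, x ∈ U (idx x)) (f : ι → X → A)
    (hf : ∀ i j, ∀ x ∈ U i ∩ U j, ∀ᶠ y in 𝓝 x, f i y - f j y = f i x - f j x) :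
    FiberBundleCore ι X A where
  baseSet := U
  isOpen_baseSet := hU
  indexAt := idx
  mem_baseSet_at := hidx
  coordChange i j x a := a + (f i x - f j x)
  coordChange_self i x _ a := by simp
  continuousOn_coordChange i j := by
    rintro ⟨x, a⟩ ⟨hx, -⟩
    refine ContinuousAt.continuousWithinAt ?_
    refine (continuousAt_const (y := a + (f i x - f j x))).congr ?_
    filter_upwards [(hf i j x hx).prod_nhds (show ∀ᶠ b in 𝓝 a, b = a by simp)] with p hp
    rw [hp.1, hp.2]
  coordChange_comp i j k x _ a := by abel

theorem exists_glued_primitive {X ι A : Type*} [TopologicalSpace X] [SimplyConnectedSpace X]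
    [LocallyPathConnectedSpace X] [AddCommGroup A]
    (U : ι → Set X) (hU : ∀ i, IsOpen (U i)) (idx : X → ι)
    (hidx : ∀ x, x ∈ U (idx x)) (f : ι → X → A)
    (hf : ∀ i j, ∀ x ∈ U i ∩ U j, ∀ᶠ y in 𝓝 x, f i y - f j y = f i x - f j x) :
    ∃ F : X → A, ∀ i, ∀ x ∈ U i, ∀ᶠ y in 𝓝 x, F y - f i y = F x - f i x := by
  let : TopologicalSpace A := ⊥
  have : DiscreteTopology A := ⟨rfl⟩
  let Z := primitiveBundle U hU idx hidx f hf
  obtain ⟨x₀⟩ : Nonempty X := inferInstance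
  obtain ⟨s, ⟨-, hs⟩, -⟩ :=
    (FiberBundle.isCoveringMap (F := A) (E := Z.Fiber)).existsUnique_continuousMap_lifts
    (ContinuousMap.id X) x₀ (⟨x₀, (0 : A)⟩ : Bundle.TotalSpace A Z.Fiber) rfl
  have hs' : ∀ x, (s x).proj = x := fun x => congrFun hs x
  let a : X → A := fun x => (s x).2
  refine ⟨fun x => f (idx x) x + a x, fun i x hx => ?_⟩
  have hloc : ∀ y ∈ U i, (Z.localTriv i (s y)).2 = a y + (f (idx y) y - f i y) := by
    intro y hy
    change a y + (f (idx (s y).proj) (s y).proj - f i (s y).proj) = _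
    rw [hs']
  have hc : ContinuousAt (fun y => (Z.localTriv i (s y)).2) x := by
    refine continuousAt_snd.comp (ContinuousAt.comp ?_ s.continuous.continuousAt)
    refine (Z.localTriv i).toOpenPartialHomeomorph.continuousAt ?_
    rw [(Z.localTriv i).mem_source]
    change (s x).proj ∈ U i
    rwa [hs']
  have := hc.preimage_mem_nhds (show {(Z.localTriv i (s x)).2} ∈ 𝓝 _ by simp)
  filter_upwards [this, (hU i).mem_nhds hx] with y hy hyU
  have hy' : (Z.localTriv i (s y)).2 = (Z.localTriv i (s x)).2 := hy
  rw [hloc y hyU, hloc x hx] at hy'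
  rw [show f (idx y) y + a y - f i y = a y + (f (idx y) y - f i y) by abel, hy']
  abel

end Gluing

section Contact

variable {E : Type*} [NormedAddCommGroup E] [NormedSpace ℝ E]
  {H : Type*} [TopologicalSpace H] {I : ModelWithCorners ℝ E H}
  {M : Type*} [TopologicalSpace M] [ChartedSpace H M] [IsManifold I ∞ M]
  {E' : Type*} [NormedAddCommGroup E'] [NormedSpace ℝ E']
  {H' : Type*} [TopologicalSpace H'] {I' : ModelWithCorners ℝ E' H'}
  {M' : Type*} [TopologicalSpace M'] [ChartedSpace H' M'] [IsManifold I' ∞ M']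

theorem OneForm.IsContact.pullback [I.Boundaryless] [I'.Boundaryless] [Nonempty M']
    {η : OneForm I M} (hη : η.IsContact) {f : M' → M} (hf : IsLocalDiffeomorph I' I ∞ f) :
    (η.pullback I' f).IsContact := by
  obtain ⟨hs, n, hn, hv⟩ := hη
  refine ⟨hs.pullback hf.contMDiff, n, ?_, fun p => ?_⟩
  · obtain ⟨p⟩ := ‹Nonempty M'›
    rw [← hn]
    exact LinearEquiv.finrank_eq (hf.mfderivToContinuousLinearEquiv (by simp) p).toLinearEquiv
  · obtain ⟨v, hv⟩ := hv (f p)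
    let e := hf.mfderivToContinuousLinearEquiv (by simp) p
    have he : ∀ w, mfderiv I' I f p (e.symm w) = w := fun w => e.apply_symm_apply w
    refine ⟨fun k => e.symm (v k), ?_⟩
    convert hv using 1
    simp only [wedgePow]
    refine Finset.sum_congr rfl fun s _ => ?_
    congr 2
    · exact congrArg (η (f p)) (he _)
    · refine Finset.prod_congr rfl fun i _ => ?_
      rw [hs.extDeriv_pullback hf.contMDiff, he, he]

theorem OneForm.smooth_ofFun [I.Boundaryless] {W : M → ℝ} (hW : ContMDiff I 𝓘(ℝ, ℝ) ∞ W) :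
    (OneForm.ofFun I W).Smooth := by
  let δ : OneForm 𝓘(ℝ, ℝ) ℝ := fun _ => ContinuousLinearMap.id ℝ ℝ
  have hδ : δ.Smooth := by
    refine OneForm.smooth_of_contDiffAt_local fun p => ?_
    have : δ.local p = fun _ => ContinuousLinearMap.id ℝ ℝ := by
      funext y
      have h : ((extChartAt 𝓘(ℝ, ℝ) p).symm : ℝ → ℝ) = id := by
        rw [extChartAt_model_space_eq_id]
        rfl
      have h' : mfderiv 𝓘(ℝ, ℝ) 𝓘(ℝ, ℝ) (extChartAt 𝓘(ℝ, ℝ) p).symm y =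
          ContinuousLinearMap.id ℝ ℝ := by
        rw [h]
        exact mfderiv_id
      exact h'
    rw [this]
    exact contDiffAt_const
  exact hδ.pullback hW

variable {E₁ : Type*} [NormedAddCommGroup E₁] [NormedSpace ℝ E₁]
  {N : Type*} [TopologicalSpace N] [ChartedSpace E₁ N] [IsManifold 𝓘(ℝ, E₁) ∞ N]
  {E₂ : Type*} [NormedAddCommGroup E₂] [NormedSpace ℝ E₂]
  {L : Type*} [TopologicalSpace L] [ChartedSpace E₂ L] [IsManifold 𝓘(ℝ, E₂) ∞ L]

theorem covectorInChart_comp_inr {q₀ q : N × L} (h₁ : q.1 ∈ (extChartAt 𝓘(ℝ, E₁) q₀.1).source)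
    (h₂ : q.2 ∈ (extChartAt 𝓘(ℝ, E₂) q₀.2).source) (a : E₁ × E₂ →L[ℝ] ℝ) :
    covectorInChart 𝓘(ℝ, E₂) q₀.2 q.2 (a.comp (ContinuousLinearMap.inr ℝ E₁ E₂)) =
      (covectorInChart (𝓘(ℝ, E₁).prod 𝓘(ℝ, E₂)) q₀ q a).comp
        (ContinuousLinearMap.inr ℝ E₁ E₂) := by
  have k₁ : MDifferentiableAt 𝓘(ℝ, E₁) 𝓘(ℝ, E₁) (extChartAt 𝓘(ℝ, E₁) q₀.1).symm
      (extChartAt 𝓘(ℝ, E₁) q₀.1 q.1) := (contMDiffAt_extChartAt_symm _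
        ((extChartAt 𝓘(ℝ, E₁) q₀.1).map_source h₁)).mdifferentiableAt (by simp)
  have k₂ : MDifferentiableAt 𝓘(ℝ, E₂) 𝓘(ℝ, E₂) (extChartAt 𝓘(ℝ, E₂) q₀.2).symm
      (extChartAt 𝓘(ℝ, E₂) q₀.2 q.2) := (contMDiffAt_extChartAt_symm _
        ((extChartAt 𝓘(ℝ, E₂) q₀.2).map_source h₂)).mdifferentiableAt (by simp)
  have h := mfderiv_prodMap (p := (extChartAt 𝓘(ℝ, E₁) q₀.1 q.1, extChartAt 𝓘(ℝ, E₂) q₀.2 q.2))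
    k₁ k₂
  have hκ : (extChartAt (𝓘(ℝ, E₁).prod 𝓘(ℝ, E₂)) q₀).symm =
      Prod.map (extChartAt 𝓘(ℝ, E₁) q₀.1).symm (extChartAt 𝓘(ℝ, E₂) q₀.2).symm := by
    rw [extChartAt_prod]
    rfl
  have hq : extChartAt (𝓘(ℝ, E₁).prod 𝓘(ℝ, E₂)) q₀ q =
      (extChartAt 𝓘(ℝ, E₁) q₀.1 q.1, extChartAt 𝓘(ℝ, E₂) q₀.2 q.2) := by
    rw [extChartAt_prod]
    rfl
  ext z
  have h₃ : (mfderiv 𝓘(ℝ, E₁ × E₂) (𝓘(ℝ, E₁).prod 𝓘(ℝ, E₂))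
      (extChartAt (𝓘(ℝ, E₁).prod 𝓘(ℝ, E₂)) q₀).symm
      (extChartAt (𝓘(ℝ, E₁).prod 𝓘(ℝ, E₂)) q₀ q) ((0, z) : E₁ × E₂) : E₁ × E₂) =
      (0, mfderiv 𝓘(ℝ, E₂) 𝓘(ℝ, E₂) (extChartAt 𝓘(ℝ, E₂) q₀.2).symm
        (extChartAt 𝓘(ℝ, E₂) q₀.2 q.2) z) := by
    rw [hκ, hq, modelWithCornersSelf_prod, ← chartedSpaceSelf_prod]
    refine (DFunLike.congr_fun h ((0, z) : E₁ × E₂)).trans ?_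
    exact Prod.ext (map_zero (mfderiv 𝓘(ℝ, E₁) 𝓘(ℝ, E₁) (extChartAt 𝓘(ℝ, E₁) q₀.1).symm
      (extChartAt 𝓘(ℝ, E₁) q₀.1 q.1))) rfl
  exact congrArg a h₃.symm

variable {EM : Type*} [NormedAddCommGroup EM] [NormedSpace ℝ EM]
  {Q : Type*} [TopologicalSpace Q] [ChartedSpace EM Q] [IsManifold 𝓘(ℝ, EM) ∞ Q]

theorem contMDiff_phi {η : OneForm 𝓘(ℝ, EM) Q} (hη : η.Smooth) {S : N × L → Q}
    (hS : ContMDiff (𝓘(ℝ, E₁).prod 𝓘(ℝ, E₂)) 𝓘(ℝ, EM) ∞ S) {W : N × L → ℝ}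
    (hW : ContMDiff (𝓘(ℝ, E₁).prod 𝓘(ℝ, E₂)) 𝓘(ℝ, ℝ) ∞ W) :
    ContMDiff (𝓘(ℝ, E₁).prod 𝓘(ℝ, E₂)) (cotangentModel 𝓘(ℝ, E₂)) ∞ (phi E₁ E₂ η S W) := by
  intro q₀
  refine contMDiffAt_cotangent_iff.2 ⟨contMDiffAt_snd, ?_⟩
  have h₁ := (contMDiffAt_cotangent_iff.1 (OneForm.smooth_ofFun hW q₀)).2
  have h₂ := (contMDiffAt_cotangent_iff.1 (hη.pullback hS q₀)).2
  have h₃ := (h₁.sub h₂).clm_comp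
    (contMDiffAt_const (c := ContinuousLinearMap.inr ℝ E₁ E₂))
  refine h₃.congr_of_eventuallyEq ?_
  have e₁ : ∀ᶠ q : N × L in 𝓝 q₀, q.1 ∈ (extChartAt 𝓘(ℝ, E₁) q₀.1).source :=
    continuousAt_fst.preimage_mem_nhds (extChartAt_source_mem_nhds q₀.1)
  have e₂ : ∀ᶠ q : N × L in 𝓝 q₀, q.2 ∈ (extChartAt 𝓘(ℝ, E₂) q₀.2).source :=
    continuousAt_snd.preimage_mem_nhds (extChartAt_source_mem_nhds q₀.2)
  filter_upwards [e₁, e₂] with q hq₁ hq₂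
  exact covectorInChart_comp_inr hq₁ hq₂ _

omit [IsManifold 𝓘(ℝ, E₁) ∞ N] [IsManifold 𝓘(ℝ, E₂) ∞ L] in
theorem mfderiv_partial_apply {E₃ : Type*} [NormedAddCommGroup E₃] [NormedSpace ℝ E₃]
    {H₃ : Type*} [TopologicalSpace H₃] {J : ModelWithCorners ℝ E₃ H₃}
    {R : Type*} [TopologicalSpace R] [ChartedSpace H₃ R] {f : N × L → R} {p : N} {l : L}
    (hf : MDifferentiableAt (𝓘(ℝ, E₁).prod 𝓘(ℝ, E₂)) J f (p, l)) (u : E₁) :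
    mfderiv 𝓘(ℝ, E₁) J (fun q => f (q, l)) p u =
      mfderiv (𝓘(ℝ, E₁).prod 𝓘(ℝ, E₂)) J f (p, l) ((u, 0) : E₁ × E₂) := by
  have h := mfderiv_comp (f := fun q : N => (q, l)) p hf
    (mdifferentiableAt_id.prodMk mdifferentiableAt_const)
  rw [mfderiv_prod_left] at h
  exact DFunLike.congr_fun h u

theorem canonicalContactForm_pullback_phi {η : OneForm 𝓘(ℝ, EM) Q} (hη : η.Smooth) {S : N × L → Q}
    (hS : ContMDiff (𝓘(ℝ, E₁).prod 𝓘(ℝ, E₂)) 𝓘(ℝ, EM) ∞ S) {W Z : N × L → ℝ} {c : ℝ}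
    (hW : IsPartialPrimitive E₁ E₂ η S W)
    (hZ : ContMDiff (𝓘(ℝ, E₁).prod 𝓘(ℝ, E₂)) 𝓘(ℝ, ℝ) ∞ Z)
    (hc : ∀ q, c • OneForm.ofFun (𝓘(ℝ, E₁).prod 𝓘(ℝ, E₂)) Z q =
      -OneForm.ofFun (𝓘(ℝ, E₁).prod 𝓘(ℝ, E₂)) W q) (q : N × L) :
    (canonicalContactForm 𝓘(ℝ, E₂) L c).pullback (𝓘(ℝ, E₁).prod 𝓘(ℝ, E₂))
      (fun q => (phi E₁ E₂ η S W q, Z q)) q = -(η.pullback (𝓘(ℝ, E₁).prod 𝓘(ℝ, E₂)) S q) := by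
  have hF := (((contMDiff_phi hη hS hW.smooth).prodMk hZ) q).mdifferentiableAt (by simp)
  refine ContinuousLinearMap.ext fun v => ?_
  refine (canonicalContactForm_pullback_apply c hF v).trans ?_
  obtain ⟨u, z⟩ : E₁ × E₂ := v
  have hz : mfderiv (𝓘(ℝ, E₁).prod 𝓘(ℝ, E₂)) 𝓘(ℝ, E₂)
      (fun k : N × L => (phi E₁ E₂ η S W k).proj) q ((u, z) : E₁ × E₂) = z :=
    DFunLike.congr_fun (mfderiv_snd (x := q)) ((u, z) : E₁ × E₂)
  have hcq := DFunLike.congr_fun (hc q) ((u, z) : E₁ × E₂)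
  have hp := DFunLike.congr_fun (hW.primitive q.2 q.1) u
  have hp₁ := mfderiv_partial_apply (p := q.1) (l := q.2)
    ((hS q).mdifferentiableAt (by simp)) u
  have hp₂ := mfderiv_partial_apply (p := q.1) (l := q.2)
    ((hW.smooth q).mdifferentiableAt (by simp)) u
  let A : E₁ × E₂ →L[ℝ] ℝ := OneForm.ofFun (𝓘(ℝ, E₁).prod 𝓘(ℝ, E₂)) W q
  let B : E₁ × E₂ →L[ℝ] ℝ := η.pullback (𝓘(ℝ, E₁).prod 𝓘(ℝ, E₂)) S q
  have hAB : B (u, 0) = A (u, 0) := by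
    refine Eq.trans ?_ (hp.trans hp₂)
    exact congrArg (η (S q)) hp₁.symm
  have hφ : (phi E₁ E₂ η S W q).2 z = A (0, z) - B (0, z) := rfl
  refine (congrArg₂ (fun r s : ℝ => r + s)
    ((congrArg (phi E₁ E₂ η S W q).2 hz).trans hφ) hcq).trans ?_
  change A (0, z) - B (0, z) + -(A (u, z)) = -(B (u, z))
  have hd : ((u, z) : E₁ × E₂) = (u, 0) + (0, z) := by simp
  rw [hd, map_add, map_add, hAB]
  ring

end Contact

section Primitive

variable {EM : Type*} [NormedAddCommGroup EM] [NormedSpace ℝ EM]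
  {M : Type*} [TopologicalSpace M] [ChartedSpace EM M] [IsManifold 𝓘(ℝ, EM) ∞ M]
  {EN : Type*} [NormedAddCommGroup EN] [NormedSpace ℝ EN]
  {N : Type*} [TopologicalSpace N] [ChartedSpace EN N] [IsManifold 𝓘(ℝ, EN) ∞ N]
  {EL : Type*} [NormedAddCommGroup EL] [NormedSpace ℝ EL]
  {L : Type*} [TopologicalSpace L] [ChartedSpace EL L] [IsManifold 𝓘(ℝ, EL) ∞ L]

omit [IsManifold 𝓘(ℝ, EM) ∞ M] [IsManifold 𝓘(ℝ, EN) ∞ N] [IsManifold 𝓘(ℝ, EL) ∞ L] in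
theorem contMDiff_partial {S : N × L → M} (hS : ContMDiff (𝓘(ℝ, EN).prod 𝓘(ℝ, EL)) 𝓘(ℝ, EM) ∞ S)
    (l : L) : ContMDiff 𝓘(ℝ, EN) 𝓘(ℝ, EM) ∞ (fun q => S (q, l)) :=
  hS.comp (contMDiff_id.prodMk contMDiff_const)

omit [IsManifold 𝓘(ℝ, EM) ∞ M] in
theorem pullbackVec_comp_mfderiv_extChartAt (η : OneForm 𝓘(ℝ, EM) M) {f : N → M}
    (hf : ContMDiff 𝓘(ℝ, EN) 𝓘(ℝ, EM) ∞ f) {x p : N} (hp : p ∈ (extChartAt 𝓘(ℝ, EN) x).source)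
    (v : EN) :
    η.pullbackVec (f ∘ (extChartAt 𝓘(ℝ, EN) x).symm) (extChartAt 𝓘(ℝ, EN) x p)
      (mfderiv 𝓘(ℝ, EN) 𝓘(ℝ, EN) (extChartAt 𝓘(ℝ, EN) x) p v : EN) =
      η.pullback 𝓘(ℝ, EN) f p v := by
  have hg : MDifferentiableAt 𝓘(ℝ, EN) 𝓘(ℝ, EM) (f ∘ (extChartAt 𝓘(ℝ, EN) x).symm)
      (extChartAt 𝓘(ℝ, EN) x p) :=
    (hf.contMDiffAt.comp _ (contMDiffAt_extChartAt_symm x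
      ((extChartAt 𝓘(ℝ, EN) x).map_source hp))).mdifferentiableAt (by simp)
  have h₁ := mfderiv_comp p hg
    (mdifferentiableAt_extChartAt (I := 𝓘(ℝ, EN)) (extChartAt_source 𝓘(ℝ, EN) x ▸ hp))
  have h₂ : (f ∘ (extChartAt 𝓘(ℝ, EN) x).symm) ∘ (extChartAt 𝓘(ℝ, EN) x) =ᶠ[𝓝 p] f := by
    filter_upwards [(isOpen_extChartAt_source x).mem_nhds hp] with k hk
    exact congrArg f ((extChartAt 𝓘(ℝ, EN) x).left_inv hk)
  rw [h₂.mfderiv_eq] at h₁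
  have hη : ∀ q r : M, q = r → ∀ w : EM, (η q : EM →L[ℝ] ℝ) w = (η r : EM →L[ℝ] ℝ) w := by
    rintro q _ rfl w; rfl
  refine Eq.trans (congrArg (η _) (DFunLike.congr_fun h₁ v).symm) (hη _ _ ?_ _)
  exact congrArg f ((extChartAt 𝓘(ℝ, EN) x).left_inv hp)

/-- The primitive of the partial pullback of `η` by integration along segments in the chart
around `x`. -/
def chartPrimitive (η : OneForm 𝓘(ℝ, EM) M) (S : N × L → M) (x : N) (q : N × L) : ℝ :=
  segmentPrimitive (η.pullbackVec ((fun p => S (p, q.2)) ∘ (extChartAt 𝓘(ℝ, EN) x).symm))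
    (extChartAt 𝓘(ℝ, EN) x x) (extChartAt 𝓘(ℝ, EN) x q.1)

variable (EN) in
/-- The preimage of a ball in the chart around `x`. -/
def chartBall (x : N) (r : ℝ) : Set N :=
  (extChartAt 𝓘(ℝ, EN) x).source ∩
    extChartAt 𝓘(ℝ, EN) x ⁻¹' Metric.ball (extChartAt 𝓘(ℝ, EN) x x) r

omit [IsManifold 𝓘(ℝ, EN) ∞ N] in
theorem isOpen_chartBall (x : N) (r : ℝ) : IsOpen (chartBall EN x r) :=
  (continuousOn_extChartAt x).isOpen_inter_preimage (isOpen_extChartAt_source x) Metric.isOpen_ball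

omit [IsManifold 𝓘(ℝ, EN) ∞ N] in
theorem mem_chartBall (x : N) {r : ℝ} (hr : 0 < r) : x ∈ chartBall EN x r :=
  ⟨mem_extChartAt_source x, Metric.mem_ball_self hr⟩

omit [IsManifold 𝓘(ℝ, EL) ∞ L] in
theorem hasMFDerivAt_chartPrimitive {η : OneForm 𝓘(ℝ, EM) M} (hη : η.Smooth) {S : N × L → M}
    (hS : ContMDiff (𝓘(ℝ, EN).prod 𝓘(ℝ, EL)) 𝓘(ℝ, EM) ∞ S) (hiso : IsPseudoIsotropic EN η S)
    {x : N} {r : ℝ}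
    (hrt : Metric.ball (extChartAt 𝓘(ℝ, EN) x x) r ⊆ (extChartAt 𝓘(ℝ, EN) x).target)
    {p : N} (hp : p ∈ chartBall EN x r) (l : L) :
    HasMFDerivAt 𝓘(ℝ, EN) 𝓘(ℝ, ℝ) (fun p => chartPrimitive (EN := EN) η S x (p, l)) p
      (η.pullback 𝓘(ℝ, EN) (fun q => S (q, l)) p) := by
  have hr : 0 < r := (dist_nonneg).trans_lt hp.2
  have hg : ∀ y ∈ Metric.ball (extChartAt 𝓘(ℝ, EN) x x) r, ContMDiffAt 𝓘(ℝ, EN) 𝓘(ℝ, EM) ∞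
      ((fun p => S (p, l)) ∘ (extChartAt 𝓘(ℝ, EN) x).symm) y := fun y hy =>
    (contMDiff_partial hS l).contMDiffAt.comp _ (contMDiffAt_extChartAt_symm x (hrt hy))
  have hd := hasFDerivAt_segmentPrimitive Metric.isOpen_ball (convex_ball _ _)
    (fun y hy => (hη.contDiffAt_pullbackVec (hg y hy)).differentiableAt (by simp))
    (fun y hy v w => by
      rw [← sub_eq_zero, hη.fderiv_pullbackVec_sub (hg y hy)]
      rw [mfderiv_comp y ((contMDiff_partial hS l).mdifferentiableAt (by simp))
        ((contMDiffAt_extChartAt_symm x (hrt hy)).mdifferentiableAt (by simp))]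
      exact hiso l _ _ _) (Metric.mem_ball_self hr) hp.2
  have hκ := (mdifferentiableAt_extChartAt (I := 𝓘(ℝ, EN))
    (extChartAt_source 𝓘(ℝ, EN) x ▸ hp.1)).hasMFDerivAt
  have h := hd.hasMFDerivAt.comp p hκ
  have hfun : (fun p => chartPrimitive (EN := EN) η S x (p, l)) =
    segmentPrimitive (η.pullbackVec ((fun p => S (p, l)) ∘ (extChartAt 𝓘(ℝ, EN) x).symm))
      (extChartAt 𝓘(ℝ, EN) x x) ∘ extChartAt 𝓘(ℝ, EN) x := rfl
  rw [hfun]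
  refine h.congr_mfderiv (ContinuousLinearMap.ext fun v => ?_)
  exact pullbackVec_comp_mfderiv_extChartAt η (contMDiff_partial hS l) hp.1 v

omit [IsManifold 𝓘(ℝ, EM) ∞ M] in
theorem contMDiffAt_comp_extChartAt_symm {S : N × L → M}
    (hS : ContMDiff (𝓘(ℝ, EN).prod 𝓘(ℝ, EL)) 𝓘(ℝ, EM) ∞ S) (x : N) (l₀ : L) {y : EN × EL}
    (hy₁ : y.1 ∈ (extChartAt 𝓘(ℝ, EN) x).target) (hy₂ : y.2 ∈ (extChartAt 𝓘(ℝ, EL) l₀).target) :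
    ContMDiffAt 𝓘(ℝ, EN × EL) 𝓘(ℝ, EM) ∞ (fun y : EN × EL =>
      S ((extChartAt 𝓘(ℝ, EN) x).symm y.1, (extChartAt 𝓘(ℝ, EL) l₀).symm y.2)) y := by
  refine hS.contMDiffAt.comp (f := fun y : EN × EL =>
    ((extChartAt 𝓘(ℝ, EN) x).symm y.1, (extChartAt 𝓘(ℝ, EL) l₀).symm y.2)) y
    (ContMDiffAt.prodMk ?_ ?_)
  · exact (contMDiffAt_extChartAt_symm x hy₁).comp y
      (contDiffAt_fst (𝕜 := ℝ) (n := ∞) (p := y)).contMDiffAt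
  · exact (contMDiffAt_extChartAt_symm l₀ hy₂).comp y
      (contDiffAt_snd (𝕜 := ℝ) (n := ∞) (p := y)).contMDiffAt

omit [IsManifold 𝓘(ℝ, EM) ∞ M] in
theorem pullbackVec_partial_eq (η : OneForm 𝓘(ℝ, EM) M) {S : N × L → M}
    (hS : ContMDiff (𝓘(ℝ, EN).prod 𝓘(ℝ, EL)) 𝓘(ℝ, EM) ∞ S) (x : N) (l₀ : L) {y : EN × EL}
    (hy₁ : y.1 ∈ (extChartAt 𝓘(ℝ, EN) x).target) (hy₂ : y.2 ∈ (extChartAt 𝓘(ℝ, EL) l₀).target) :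
    η.pullbackVec ((fun p => S (p, (extChartAt 𝓘(ℝ, EL) l₀).symm y.2)) ∘
      (extChartAt 𝓘(ℝ, EN) x).symm) y.1 =
      (η.pullbackVec (fun y : EN × EL => S ((extChartAt 𝓘(ℝ, EN) x).symm y.1,
        (extChartAt 𝓘(ℝ, EL) l₀).symm y.2)) y).comp (ContinuousLinearMap.inl ℝ EN EL) := by
  have hG : MDifferentiableAt 𝓘(ℝ, EN × EL) 𝓘(ℝ, EM) (fun y : EN × EL =>
      S ((extChartAt 𝓘(ℝ, EN) x).symm y.1, (extChartAt 𝓘(ℝ, EL) l₀).symm y.2)) (y.1, y.2) :=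
    (contMDiffAt_comp_extChartAt_symm hS x l₀ hy₁ hy₂).mdifferentiableAt (by simp)
  have h := mfderiv_comp (f := fun u : EN => (u, y.2)) y.1 hG
    (hasFDerivAt_prodMk_left y.1 y.2).differentiableAt.mdifferentiableAt
  rw [(hasFDerivAt_prodMk_left y.1 y.2).hasMFDerivAt.mfderiv] at h
  ext v
  exact congrArg (η _) (DFunLike.congr_fun h v)

theorem contMDiffAt_chartPrimitive [FiniteDimensional ℝ EN] [FiniteDimensional ℝ EL]
    {η : OneForm 𝓘(ℝ, EM) M} (hη : η.Smooth) {S : N × L → M}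
    (hS : ContMDiff (𝓘(ℝ, EN).prod 𝓘(ℝ, EL)) 𝓘(ℝ, EM) ∞ S) {x : N} {r : ℝ}
    (hrt : Metric.ball (extChartAt 𝓘(ℝ, EN) x x) r ⊆ (extChartAt 𝓘(ℝ, EN) x).target)
    {q : N × L} (hq : q.1 ∈ chartBall EN x r) :
    ContMDiffAt (𝓘(ℝ, EN).prod 𝓘(ℝ, EL)) 𝓘(ℝ, ℝ) ∞ (chartPrimitive (EN := EN) η S x) q := by
  have hr : 0 < r := (dist_nonneg).trans_lt hq.2
  set B := Metric.ball (extChartAt 𝓘(ℝ, EN) x x) r with hB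
  set κ := extChartAt 𝓘(ℝ, EN) x with hκ
  set μ := extChartAt 𝓘(ℝ, EL) q.2 with hμ
  have hT : IsOpen μ.target := isOpen_extChartAt_target q.2
  have hα : ∀ y ∈ B ×ˢ μ.target, ContDiffAt ℝ ∞ (fun y : EN × EL =>
      η.pullbackVec ((fun p => S (p, μ.symm y.2)) ∘ κ.symm) y.1) y := by
    intro y hy
    refine ((hη.contDiffAt_pullbackVec
      (contMDiffAt_comp_extChartAt_symm hS x q.2 (hrt hy.1) hy.2)).clm_comp
      (contDiffAt_const (c := ContinuousLinearMap.inl ℝ EN EL))).congr_of_eventuallyEq ?_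
    filter_upwards [(Metric.isOpen_ball.prod hT).mem_nhds hy] with u hu
    exact pullbackVec_partial_eq η hS x q.2 (hrt hu.1) hu.2
  have h := contDiffOn_segmentPrimitive Metric.isOpen_ball (convex_ball _ _) hT hα
    (Metric.mem_ball_self hr)
  have hq' : (κ q.1, μ q.2) ∈ B ×ˢ μ.target := ⟨hq.2, mem_extChartAt_target q.2⟩
  have h₁ := (h.contDiffAt ((Metric.isOpen_ball.prod hT).mem_nhds hq')).contMDiffAt
  have h₂ : ContMDiffAt (𝓘(ℝ, EN).prod 𝓘(ℝ, EL)) 𝓘(ℝ, EN × EL) ∞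
      (fun u : N × L => (κ u.1, μ u.2)) q := by
    refine ContMDiffAt.prodMk_space ?_ ?_
    · exact (contMDiffAt_extChartAt' (extChartAt_source 𝓘(ℝ, EN) x ▸ hq.1)).comp q contMDiffAt_fst
    · exact contMDiffAt_extChartAt.comp q contMDiffAt_snd
  refine (h₁.comp q h₂).congr_of_eventuallyEq ?_
  have : ∀ᶠ u : N × L in 𝓝 q, u.2 ∈ μ.source :=
    continuousAt_snd.preimage_mem_nhds (extChartAt_source_mem_nhds q.2)
  filter_upwards [this] with u hu
  simp only [chartPrimitive, Function.comp_def]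
  rw [μ.left_inv hu]

omit [IsManifold 𝓘(ℝ, EN) ∞ N] in
theorem exists_chartBall_subset (x : N) {O : Set N} (hO : O ∈ 𝓝 x) : ∃ r > 0,
    Metric.ball (extChartAt 𝓘(ℝ, EN) x x) r ⊆ (extChartAt 𝓘(ℝ, EN) x).target ∧
      chartBall EN x r ⊆ O := by
  have h₁ := extChartAt_target_mem_nhds (I := 𝓘(ℝ, EN)) x
  have h₂ : (extChartAt 𝓘(ℝ, EN) x).symm ⁻¹' O ∈ 𝓝 (extChartAt 𝓘(ℝ, EN) x x) :=
    (continuousAt_extChartAt_symm x).preimage_mem_nhds (by rwa [extChartAt_to_inv])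
  obtain ⟨r, hr, h⟩ := Metric.mem_nhds_iff.1 (inter_mem h₁ h₂)
  refine ⟨r, hr, fun y hy => (h hy).1, fun p hp => ?_⟩
  have := (h hp.2).2
  rwa [Set.mem_preimage, (extChartAt 𝓘(ℝ, EN) x).left_inv hp.1] at this

theorem eventually_forall_eq_of_hasMFDerivAt_zero {ι : Type*} {h : ι → N → ℝ} {O : Set N} {x : N}
    (hO : O ∈ 𝓝 x) (hd : ∀ i, ∀ p ∈ O, HasMFDerivAt 𝓘(ℝ, EN) 𝓘(ℝ, ℝ) (h i) p 0) :
    ∀ᶠ y in 𝓝 x, ∀ i, h i y = h i x := by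
  obtain ⟨r, hr, hrt, hrO⟩ := exists_chartBall_subset (EN := EN) x hO
  filter_upwards [(isOpen_chartBall (EN := EN) x r).mem_nhds (mem_chartBall x hr)] with y hy i
  have hd' : ∀ z ∈ Metric.ball (extChartAt 𝓘(ℝ, EN) x x) r,
      HasFDerivAt (h i ∘ (extChartAt 𝓘(ℝ, EN) x).symm) (0 : EN →L[ℝ] ℝ) z := by
    intro z hz
    have hzO : (extChartAt 𝓘(ℝ, EN) x).symm z ∈ O := by
      refine hrO ⟨(extChartAt 𝓘(ℝ, EN) x).map_target (hrt hz), ?_⟩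
      rwa [Set.mem_preimage, (extChartAt 𝓘(ℝ, EN) x).right_inv (hrt hz)]
    have := (hd i _ hzO).comp z
      ((contMDiffAt_extChartAt_symm x (hrt hz)).mdifferentiableAt (by simp)).hasMFDerivAt
    rw [ContinuousLinearMap.zero_comp] at this
    exact this.hasFDerivAt
  have hc := Metric.isOpen_ball.is_const_of_fderiv_eq_zero (𝕜 := ℝ)
    (convex_ball (extChartAt 𝓘(ℝ, EN) x x) r).isPreconnected
    (fun z hz => (hd' z hz).differentiableAt.differentiableWithinAt)
    (fun z hz => (hd' z hz).fderiv) hy.2 (Metric.mem_ball_self hr)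
  simpa only [Function.comp_apply, (extChartAt 𝓘(ℝ, EN) x).left_inv hy.1, extChartAt_to_inv] using hc

theorem exists_isPartialPrimitive [FiniteDimensional ℝ EN] [FiniteDimensional ℝ EL]
    [SimplyConnectedSpace N] {η : OneForm 𝓘(ℝ, EM) M} (hη : η.Smooth) {S : N × L → M}
    (hS : ContMDiff (𝓘(ℝ, EN).prod 𝓘(ℝ, EL)) 𝓘(ℝ, EM) ∞ S) (hiso : IsPseudoIsotropic EN η S) :
    ∃ W : N × L → ℝ, IsPartialPrimitive EN EL η S W := by
  classical
  have : LocallyPathConnectedSpace N := ChartedSpace.locallyPathConnectedSpace EN N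
  choose r hr hrt _ using fun x : N => exists_chartBall_subset (EN := EN) x univ_mem
  have hsm : ∀ x, ∀ p ∈ chartBall EN x (r x), ContMDiff 𝓘(ℝ, EL) 𝓘(ℝ, ℝ) ∞
      (fun l => chartPrimitive (EN := EN) η S x (p, l)) := fun x p hp l =>
    ContMDiffAt.comp (g := chartPrimitive (EN := EN) η S x) (f := fun l => (p, l)) l
      (contMDiffAt_chartPrimitive hη hS (hrt x) hp)
      (contMDiffAt_const.prodMk contMDiffAt_id)
  let f : N → N → C^∞⟮𝓘(ℝ, EL), L; 𝓘(ℝ, ℝ), ℝ⟯ := fun x p =>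
    if hp : p ∈ chartBall EN x (r x) then ⟨_, hsm x p hp⟩ else 0
  have hf : ∀ x, ∀ p ∈ chartBall EN x (r x), ∀ l, f x p l = chartPrimitive (EN := EN) η S x (p, l) := by
    intro x p hp l
    have h : f x p = ⟨_, hsm x p hp⟩ := dif_pos hp
    rw [h]
    rfl
  obtain ⟨F, hF⟩ := exists_glued_primitive (fun x : N => chartBall EN x (r x))
    (fun x => isOpen_chartBall x _) id (fun x => mem_chartBall x (hr x)) f (by
      rintro x y p ⟨hpx, hpy⟩
      have hO := ((isOpen_chartBall (EN := EN) x (r x)).inter (isOpen_chartBall y (r y))).mem_nhds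
        ⟨hpx, hpy⟩
      have h := eventually_forall_eq_of_hasMFDerivAt_zero (EN := EN) (ι := L)
        (h := fun l p => chartPrimitive (EN := EN) η S x (p, l) -
          chartPrimitive (EN := EN) η S y (p, l)) hO
        (fun l p hp => by
          have h' := (hasMFDerivAt_chartPrimitive hη hS hiso (hrt x) hp.1 l).sub
            (hasMFDerivAt_chartPrimitive hη hS hiso (hrt y) hp.2 l)
          rwa [sub_self] at h')
      filter_upwards [h, hO] with q hq hqO
      ext l
      have := hq l
      rw [← hf x q hqO.1 l, ← hf y q hqO.2 l, ← hf x p hpx l, ← hf y p hpy l] at this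
      exact this)
  have hloc : ∀ x : N, ∀ᶠ p in 𝓝 x, ∀ l, F p l =
      chartPrimitive (EN := EN) η S x (p, l) + (F x l - chartPrimitive (EN := EN) η S x (x, l)) := by
    intro x
    have hx := mem_chartBall (EN := EN) x (hr x)
    filter_upwards [hF x x hx, (isOpen_chartBall x (r x)).mem_nhds hx] with p hp hpB l
    have := congrArg (fun g : C^∞⟮𝓘(ℝ, EL), L; 𝓘(ℝ, ℝ), ℝ⟯ => g l) hp
    have h' : F p l - f x p l = F x l - f x x l := this
    rw [hf x p hpB, hf x x hx] at h'
    linarith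
  refine ⟨fun q => F q.1 q.2, fun q => ?_, fun l x => ?_⟩
  · have hx := mem_chartBall (EN := EN) q.1 (hr q.1)
    have h₁ : ContMDiffAt (𝓘(ℝ, EN).prod 𝓘(ℝ, EL)) 𝓘(ℝ, ℝ) ∞ (fun u : N × L =>
        chartPrimitive (EN := EN) η S q.1 u +
          (F q.1 u.2 - chartPrimitive (EN := EN) η S q.1 (q.1, u.2))) q :=
      (contMDiffAt_chartPrimitive hη hS (hrt q.1) hx).add
        (((F q.1).contMDiff.comp contMDiff_snd).sub ((hsm q.1 q.1 hx).comp contMDiff_snd)).contMDiffAt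
    refine h₁.congr_of_eventuallyEq ?_
    filter_upwards [continuousAt_fst.eventually (hloc q.1)] with u hu
    exact hu u.2
  · have hx := mem_chartBall (EN := EN) x (hr x)
    have h₁ := ((hasMFDerivAt_chartPrimitive hη hS hiso (hrt x) hx l).add
      (hasMFDerivAt_const (F x l - chartPrimitive (EN := EN) η S x (x, l)) x)).congr_mfderiv
      (add_zero _)
    exact (h₁.congr_of_eventuallyEq ((hloc x).mono fun p hp => hp l)).mfderiv.symm

end Primitive

end ContactHJ

end

theorem mainTheorem9
    {EM : Type*} [NormedAddCommGroup EM] [NormedSpace ℝ EM] [FiniteDimensional ℝ EM]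
    {M : Type*} [TopologicalSpace M] [T2Space M] [SecondCountableTopology M]
    [ChartedSpace EM M] [IsManifold 𝓘(ℝ, EM) ∞ M]
    {EN : Type*} [NormedAddCommGroup EN] [NormedSpace ℝ EN] [FiniteDimensional ℝ EN]
    {N : Type*} [TopologicalSpace N] [T2Space N] [SecondCountableTopology N]
    [ChartedSpace EN N] [IsManifold 𝓘(ℝ, EN) ∞ N]
    {EL : Type*} [NormedAddCommGroup EL] [NormedSpace ℝ EL] [FiniteDimensional ℝ EL]
    {L : Type*} [TopologicalSpace L] [T2Space L] [SecondCountableTopology L]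
    [ChartedSpace EL L] [IsManifold 𝓘(ℝ, EL) ∞ L]
    [SimplyConnectedSpace N]
    (η : ContactHJ.OneForm 𝓘(ℝ, EM) M) (hη : η.IsContact)
    (Pr : M → N) (hPr : Manifold.IsSubmersion 𝓘(ℝ, EM) 𝓘(ℝ, EN) ∞ Pr)
    (hPr_surj : Function.Surjective Pr)
    (X : (m : M) → TangentSpace 𝓘(ℝ, EM) m)
    (hX : ContMDiff 𝓘(ℝ, EM) 𝓘(ℝ, EM).tangent ∞
      (fun m => (⟨m, X m⟩ : TangentBundle 𝓘(ℝ, EM) M)))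
    (S : N × L → M) (hS : ContactHJ.IsCompleteSolution EN EL Pr X S)
    (hiso : ContactHJ.IsPseudoIsotropic EN η S) :
    (∃ W : N × L → ℝ, ContactHJ.IsPartialPrimitive EN EL η S W) ∧
    ∀ W : N × L → ℝ, ContactHJ.IsPartialPrimitive EN EL η S W →
      ContactHJ.IsContactAntimorphism
        (η.pullback (𝓘(ℝ, EN).prod 𝓘(ℝ, EL)) S)
        (ContactHJ.canonicalContactForm 𝓘(ℝ, EL) L (-1))
        (fun q => (ContactHJ.phi EN EL η S W q, W q)) ∧
      ContactHJ.IsContactAntimorphism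
        (η.pullback (𝓘(ℝ, EN).prod 𝓘(ℝ, EL)) S)
        (ContactHJ.canonicalContactForm 𝓘(ℝ, EL) L 1)
        (fun q => (ContactHJ.phi EN EL η S W q, -W q)) := by
  have hSs : ContMDiff (𝓘(ℝ, EN).prod 𝓘(ℝ, EL)) 𝓘(ℝ, EM) ∞ S := hS.localDiffeo.contMDiff
  have : Nonempty (N × L) := by
    obtain ⟨p⟩ : Nonempty N := inferInstance
    obtain ⟨m, -⟩ := hPr_surj p
    obtain ⟨q, -⟩ := hS.surjective m
    exact ⟨q⟩
  refine ⟨ContactHJ.exists_isPartialPrimitive hη.1 hSs hiso, fun W hW => ⟨?_, ?_⟩⟩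
  · exact
      { source_contact := hη.pullback hS.localDiffeo
        target_contact := ContactHJ.canonicalContactForm_isContact (by norm_num)
        smooth := (ContactHJ.contMDiff_phi hη.1 hSs hW.smooth).prodMk hW.smooth
        pullback_eq := ContactHJ.canonicalContactForm_pullback_phi hη.1 hSs hW hW.smooth
          fun q => ContinuousLinearMap.ext fun v => neg_one_mul _ }
  · have hneg : ∀ q, (1 : ℝ) • ContactHJ.OneForm.ofFun (𝓘(ℝ, EN).prod 𝓘(ℝ, EL)) (fun q => -W q) q =
        -ContactHJ.OneForm.ofFun (𝓘(ℝ, EN).prod 𝓘(ℝ, EL)) W q := fun q => by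
      rw [one_smul]
      exact mfderiv_neg
    exact
      { source_contact := hη.pullback hS.localDiffeo
        target_contact := ContactHJ.canonicalContactForm_isContact one_ne_zero
        smooth := (ContactHJ.contMDiff_phi hη.1 hSs hW.smooth).prodMk hW.smooth.neg
        pullback_eq := ContactHJ.canonicalContactForm_pullback_phi hη.1 hSs hW hW.smooth.neg hneg }
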